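/- Let $d\ge 2$, let $\Omega\subset\mathbb R^d$ be bounded, convex and open, let $g:\partial\Omega\to[0,\infty)$ be bounded and lower semicontinuous, and let $T>0$. For $A\subset\mathbb R^d$, $\mathcal M(A)$ denotes the finite signed Borel measures carried by $A$ and $\mathcal M^+(A)$ its non-negative elements; $L^\infty(0,T;\mathcal M(A))$ is understood in the weak-$*$ measurable sense. For $\eta\in\mathcal M^+(\mathbb R^d)$ let $X_\eta$ be the set of $\psi\in L^2_\eta(\mathbb R^d;\mathbb R^d)$ such that ${\rm div}(\psi\eta)$ is a finite measure, let $T_\eta(x)$ be the $\eta$-essential union of $\{\psi(x):\psi\in X_\eta\}$ ($\eta$-a.e. the smallest field of subspaces containing every $\psi\in X_\eta$ $\eta$-a.e.), and for $\varphi\in C_c^\infty(\mathbb R^d)$ let $D_\eta\varphi(x)$ be the orthogonal projection of $D\varphi(x)$ on $T_\eta(x)$. One writes $w=D_\eta v$ if there are $v_n\in C^\infty_c(\mathbb R^d)$ with $v_n\to v$ uniformly and $D_\eta v_n\rightharpoonup w$ weakly in $L^2_\eta$. If $\eta$ is carried by $\Omega$ and $u\in W^{1,\infty}(\Omega)$,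 then $D_\eta u:=D_\eta v$ for any continuous compactly supported extension $v$ of $u$ to $\mathbb R^d$. Let $f\in L^\infty(0,T;\mathcal M(\Omega))$ and $u_0:\overline\Omega\to\mathbb R$. Call $(u,\mu,\nu)$ a solution with data $(f,u_0)$ if $$u\in L^\infty(0,T;W^{1,\infty}(\Omega)),\quad \partial_tu\in L^\infty(0,T;\mathcal M(\Omega)),\quad \mu\in L^\infty(0,T;\mathcal M^+(\Omega)),\quad \nu\in L^\infty(0,T;\mathcal M(\partial\Omega)),$$ and the following hold (where $u$ denotes its representative that is continuous from $[0,T]$ to $L^2(\Omega)$ and, at each time, continuous on $\overline\Omega$): - (PDE) $\partial_tu-{\rm div}(D_{\mu_t}u\,\mu_t)=f-\nu$ in $\mathbb R^d\times]0,T[$, i.e. for every $\varphi\in C_c^\infty(\mathbb R^d)$, $$\frac{d}{dt}\int_\Omega u(x,t)\varphi(x)\,dx+\int D_{\mu_t}u\cdot D\varphi\,d\mu_t=\int_\Omega\varphi\,df_t-\int_{\partial\Omega}\varphi\,d\nu_t\quad\text{in }\mathcal D'(]0,T[);$$ - (C) $|Du|\le1$ a.e. in $\Omega\times]0,T[$,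 and $|D_{\mu_t}u|=1$ $\mu_t$-a.e. for a.e. $t\in]0,T[$; - (B1) $0\le u(x,t)\le g(x)$ for all $x\in\partial\Omega$ and a.e. $t\in]0,T[$; - $u(x,t)=0$ for $\nu_t^-$-a.e. $x$ and $u(x,t)=g(x)$ for $\nu_t^+$-a.e. $x$, for a.e. $t\in]0,T[$; - $u(x,0)=u_0(x)$ for all $x\in\overline\Omega$. Then: 1. (Comparison) Let $(u^i,\mu^i,\nu^i)$ be a solution with data $(f^i,u_0^i)$, $i=1,2$. If $f^1_t\ge f^2_t$ for a.e. $t\in]0,T[$ and $u^1_0\ge u^2_0$ on $\overline\Omega$, then $u^1\ge u^2$ on $\overline\Omega\times[0,T]$. 2. (Uniqueness of $u$) If $(u^1,\mu^1,\nu^1)$ and $(u^2,\mu^2,\nu^2)$ are solutions with the same data $(f,u_0)$, then $u^1=u^2$ on $\overline\Omega\times[0,T]$. 3. (Monotonicity in time) If $(u,\mu,\nu)$ is a solution with data $(f,u_0)$ and $f_t\ge0$ for a.e. $t\in]0,T[$, then $t\mapsto u(x,t)$ is nondecreasing on $[0,T]$ for every $x\in\overline\Omega$. -/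

import Mathlib

open MeasureTheory Set Filter Topology
open scoped ContDiff

noncomputable section

namespace Sandpile

/-- The Euclidean space `ℝ^d`. -/
abbrev Space (d : ℕ) : Type := EuclideanSpace ℝ (Fin d)

/-- `φ ∈ 𝒟(U)`: smooth, with compact support contained in `U`. -/
structure IsTestFunction {F : Type*} [NormedAddCommGroup F] [NormedSpace ℝ F]
    (U : Set F) (φ : F → ℝ) : Prop where
  smooth : ContDiff ℝ ∞ φ
  compact : HasCompactSupport φ
  support : tsupport φ ⊆ U

/-- Lebesgue measure on the time interval `]0,T[`. -/
def timeMeasure (T : ℝ) : Measure ℝ := volume.restrict (Ioo 0 T)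

/-- The pairing `⟨m, φ⟩` of a signed measure with a function. -/
def signedIntegral {d : ℕ} (m : SignedMeasure (Space d)) (φ : Space d → ℝ) : ℝ :=
  (∫ x, φ x ∂m.toJordanDecomposition.posPart) - ∫ x, φ x ∂m.toJordanDecomposition.negPart

/-- `m ∈ L^∞(0,T; 𝓜(A))`: essentially bounded in total variation, weakly-* measurable, with values
in the finite signed measures carried by `A`. -/
structure MemLinftySigned {d : ℕ} (T : ℝ) (A : Set (Space d))
    (m : ℝ → SignedMeasure (Space d)) : Prop where
  carried : ∀ᵐ t ∂timeMeasure T, (m t).totalVariation Aᶜ = 0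
  bounded : ∃ C : NNReal, ∀ᵐ t ∂timeMeasure T, (m t).totalVariation univ ≤ C
  measurable : ∀ φ : Space d → ℝ, Continuous φ → HasCompactSupport φ →
    AEStronglyMeasurable (fun t => signedIntegral (m t) φ) (timeMeasure T)

/-- `μ ∈ L^∞(0,T; 𝓜⁺(A))`: the same for non-negative measures. -/
structure MemLinftyPos {d : ℕ} (T : ℝ) (A : Set (Space d))
    (μ : ℝ → Measure (Space d)) : Prop where
  carried : ∀ᵐ t ∂timeMeasure T, μ t Aᶜ = 0
  bounded : ∃ C : NNReal, ∀ᵐ t ∂timeMeasure T, μ t univ ≤ C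
  measurable : ∀ φ : Space d → ℝ, Continuous φ → HasCompactSupport φ →
    AEStronglyMeasurable (fun t => ∫ x, φ x ∂μ t) (timeMeasure T)

/-- `G` is the weak (distributional) gradient of `v` on `Ω`. -/
structure HasWeakGradient {d : ℕ} (Ω : Set (Space d)) (v : Space d → ℝ)
    (G : Space d → Space d) : Prop where
  locInt : LocallyIntegrableOn v Ω
  locIntGrad : LocallyIntegrableOn G Ω
  byParts : ∀ φ : Space d → ℝ, IsTestFunction Ω φ →
    ∫ x in Ω, v x • gradient φ x = - ∫ x in Ω, φ x • G x

/-- `u ∈ L^∞(0,T; W^{1,∞}(Ω))`. -/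
structure MemLinftyW1infty {d : ℕ} (T : ℝ) (Ω : Set (Space d))
    (u : ℝ → Space d → ℝ) : Prop where
  measurable : AEStronglyMeasurable (fun p : ℝ × Space d => u p.1 p.2)
    ((timeMeasure T).prod (volume.restrict Ω))
  bounded : ∃ C : ℝ, ∀ᵐ t ∂timeMeasure T, ∃ G : Space d → Space d,
    HasWeakGradient Ω (u t) G ∧ ∀ᵐ x ∂volume.restrict Ω, |u t x| ≤ C ∧ ‖G x‖ ≤ C

/-- `m` is the distributional time derivative of `u` on `Ω × ]0,T[`. -/
def HasWeakTimeDerivative {d : ℕ} (T : ℝ) (Ω : Set (Space d))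
    (u : ℝ → Space d → ℝ) (m : ℝ → SignedMeasure (Space d)) : Prop :=
  ∀ Φ : ℝ × Space d → ℝ, IsTestFunction (Ioo 0 T ×ˢ Ω) Φ →
    ∫ t, (∫ x in Ω, u t x * deriv (fun s => Φ (s, x)) t) ∂timeMeasure T
      = - ∫ t, signedIntegral (m t) (fun x => Φ (t, x)) ∂timeMeasure T

/-- The space `X_η` of the vector fields `ψ ∈ L²_η` for which `div (ψ η)` is a bounded measure. -/
structure MemTangentFields {d : ℕ} (η : Measure (Space d)) (ψ : Space d → Space d) : Prop where
  memLp : MemLp ψ 2 η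
  divBounded : ∃ K : ℝ, ∀ φ : Space d → ℝ, IsTestFunction univ φ →
    ∀ c : ℝ, (∀ x, |φ x| ≤ c) → ∫ x, inner ℝ (gradient φ x) (ψ x) ∂η ≤ K * c

/-- `S x = T_η(x)` is the `η`-essential union of the values `ψ x`, `ψ ∈ X_η`: `η`-a.e. the smallest
field of subspaces that contains every `ψ ∈ X_η` `η`-a.e.  It is unique up to an `η`-null set. -/
structure IsTangentSpace {d : ℕ} (η : Measure (Space d))
    (S : Space d → Submodule ℝ (Space d)) : Prop where
  mem : ∀ ψ : Space d → Space d, MemTangentFields η ψ → ∀ᵐ x ∂η, ψ x ∈ S x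
  minimal : ∀ S' : Space d → Submodule ℝ (Space d),
    (∀ ψ : Space d → Space d, MemTangentFields η ψ → ∀ᵐ x ∂η, ψ x ∈ S' x) →
      ∀ᵐ x ∂η, S x ≤ S' x

/-- `w = D_η v`, the tangential gradient: there are `v_n ∈ 𝒟(ℝ^d)` with `v_n → v` uniformly and
`D_η v_n ⇀ w` weakly in `L²_η`, where `D_η v_n (x)` is the orthogonal projection of `D v_n (x)` on
the tangent space `T_η(x)`. -/
def HasTangentialGradient {d : ℕ} (η : Measure (Space d)) (v : Space d → ℝ)
    (w : Space d → Space d) : Prop :=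
  MemLp w 2 η ∧
  ∃ S : Space d → Submodule ℝ (Space d), IsTangentSpace η S ∧
  ∃ vn : ℕ → Space d → ℝ, (∀ n, IsTestFunction univ (vn n)) ∧
    TendstoUniformly vn v atTop ∧
    ∀ ψ : Space d → Space d, MemLp ψ 2 η →
      Tendsto (fun n => ∫ x, inner ℝ ((S x).starProjection (gradient (vn n) x)) (ψ x) ∂η) atTop
        (𝓝 (∫ x, inner ℝ (w x) (ψ x) ∂η))

/-- `w = D_η u` for a function `u` on `Ω` and a measure `η` carried by `Ω`: the tangential gradient
of a continuous compactly supported extension of `u` to `ℝ^d`. -/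
def HasTangentialGradientOn {d : ℕ} (Ω : Set (Space d)) (η : Measure (Space d))
    (u : Space d → ℝ) (w : Space d → Space d) : Prop :=
  ∃ v : Space d → ℝ, Continuous v ∧ HasCompactSupport v ∧ EqOn v u Ω ∧
    HasTangentialGradient η v w

/-- (PDE): `∂_t u - div (w_t μ_t) = f - ν` in `ℝ^d × ]0,T[`, i.e. for every `φ ∈ 𝒟(ℝ^d)`,
`d/dt ∫_Ω u φ dx + ∫ w_t · Dφ dμ_t = ∫ φ df_t - ∫ φ dν_t` in `𝒟'(]0,T[)`.  The flux term has to be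
integrable in time in order to be a distribution on `]0,T[`. -/
def SatisfiesPDE {d : ℕ} (T : ℝ) (Ω : Set (Space d)) (f : ℝ → SignedMeasure (Space d))
    (u : ℝ → Space d → ℝ) (μ : ℝ → Measure (Space d)) (w : ℝ → Space d → Space d)
    (ν : ℝ → SignedMeasure (Space d)) : Prop :=
  ∀ φ : Space d → ℝ, IsTestFunction univ φ →
    Integrable (fun t => ∫ x, inner ℝ (w t x) (gradient φ x) ∂μ t) (timeMeasure T) ∧
    ∀ h : ℝ → ℝ, IsTestFunction (Ioo 0 T) h →
      - (∫ t, deriv h t * (∫ x in Ω, u t x * φ x) ∂timeMeasure T)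
        + ∫ t, h t * (∫ x, inner ℝ (w t x) (gradient φ x) ∂μ t) ∂timeMeasure T
      = ∫ t, h t * (signedIntegral (f t) φ - signedIntegral (ν t) φ) ∂timeMeasure T

/-- `(u, μ, ν)` solves the growing sandpile problem on `Ω × ]0,T[` with source `f`, wall height `g`
on `∂Ω` and initial datum `u₀`.  The function `u` is represented by its version which is continuous
on `[0,T]` with values in `L²(Ω)` and, at each time, continuous on the closure of `Ω`; this gives
its meaning to the initial condition and to the values on `∂Ω`. -/
structure IsSolution {d : ℕ} (T : ℝ) (Ω : Set (Space d)) (g : Space d → ℝ)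
    (f : ℝ → SignedMeasure (Space d)) (u₀ : Space d → ℝ)
    (u : ℝ → Space d → ℝ) (μ : ℝ → Measure (Space d))
    (ν : ℝ → SignedMeasure (Space d)) : Prop where
  /-- regularity of `u` -/
  mem_u : MemLinftyW1infty T Ω u
  continuous_space : ∀ t ∈ Icc 0 T, ContinuousOn (u t) (closure Ω)
  continuous_time : ∀ t ∈ Icc 0 T,
    Tendsto (fun s => eLpNorm (fun x => u s x - u t x) 2 (volume.restrict Ω))
      (𝓝[Icc 0 T] t) (𝓝 0)
  /-- `∂_t u ∈ L^∞(0,T; 𝓜(Ω))` -/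
  mem_time_deriv : ∃ m : ℝ → SignedMeasure (Space d),
    MemLinftySigned T Ω m ∧ HasWeakTimeDerivative T Ω u m
  mem_μ : MemLinftyPos T Ω μ
  mem_ν : MemLinftySigned T (frontier Ω) ν
  /-- `|Du| ≤ 1` in `Ω × ]0,T[` -/
  slope : ∀ᵐ t ∂timeMeasure T, ∃ G : Space d → Space d,
    HasWeakGradient Ω (u t) G ∧ ∀ᵐ x ∂volume.restrict Ω, ‖G x‖ ≤ 1
  /-- (PDE) with `w t = D_{μ_t} u(t)`, and `|D_{μ_t} u| = 1` holds `μ_t`-a.e. -/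
  flux : ∃ w : ℝ → Space d → Space d,
    (∀ᵐ t ∂timeMeasure T, HasTangentialGradientOn Ω (μ t) (u t) (w t)) ∧
    (∀ᵐ t ∂timeMeasure T, ∀ᵐ x ∂μ t, ‖w t x‖ = 1) ∧
    SatisfiesPDE T Ω f u μ w ν
  /-- `0 ≤ u ≤ g` on `∂Ω × ]0,T[` -/
  boundary : ∀ᵐ t ∂timeMeasure T, ∀ x ∈ frontier Ω, 0 ≤ u t x ∧ u t x ≤ g x
  /-- `u = 0` holds `ν⁻`-a.e. -/
  boundary_neg : ∀ᵐ t ∂timeMeasure T, ∀ᵐ x ∂(ν t).toJordanDecomposition.negPart, u t x = 0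
  /-- `u = g` holds `ν⁺`-a.e. -/
  boundary_pos : ∀ᵐ t ∂timeMeasure T, ∀ᵐ x ∂(ν t).toJordanDecomposition.posPart, u t x = g x
  initial : ∀ x ∈ closure Ω, u 0 x = u₀ x

end Sandpile

end

open scoped NNReal

namespace Sandpile

/-! Write `m = ∂ₜu` and let `Λ = f - ν - m` at a fixed time, so that the equation reads `∫ w · Dφ dμ
= Λ(φ)` with `w = D_μ u`, `|w| = 1`. For a `1`-Lipschitz `v` the left side is at most the mass of
`μ`, while for `v = u` it is `∫ |w|² dμ`, exactly that mass. Hence `Λ(v) ≤ Λ(u)` for every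
`1`-Lipschitz `v` (`signedIntegral_le_of_tangentialGradient`), an inequality from which `μ` has
disappeared.

Given two solutions put `p = (u₂ - u₁)⁺`. Both `max u₁ u₂ = u₁ + p` and `min u₁ u₂ = u₂ - p` are
`1`-Lipschitz; used as competitors for `u₁` and `u₂` they give `Λ₁(p) ≤ 0 ≤ Λ₂(p)`. The sources are
ordered. The boundary terms have a good sign, because `p = 0` where `u₁ = g` or `u₂ = 0`, that is,
`ν₁⁺`-a.e. and `ν₂⁻`-a.e. What remains is `⟨m₂ - m₁, p⟩ ≤ 0` (`signedIntegral_posPart_sub_le`),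
formally `d/dt ∫ p² ≤ 0`.

Since `m` is only a measure, the chain rule is replaced by a difference inequality over short time
intervals (`IsFlow.exists_energy_increment_le`), whose errors vanish because `u₁` and `u₂` are
jointly continuous up to the boundary. This gives comparison (`IsFlow.le`). Uniqueness is comparison
in both directions. Monotonicity is comparison on `[s,T]` with the state at time `s` frozen, which
satisfies the variational inequality with zero source (`IsFlow.const`). -/

instance isFiniteMeasure_timeMeasure (T : ℝ) : IsFiniteMeasure (timeMeasure T) := by
  unfold timeMeasure
  infer_instance

/-! ### Pairings with signed measures carried by a set -/

theorem integrable_of_compact_carrier {d : ℕ} {F : Type*} [NormedAddCommGroup F] {K : Set (Space d)}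
    (hK : IsCompact K) {η : Measure (Space d)} [IsFiniteMeasure η] (hη : η Kᶜ = 0)
    {φ : Space d → F} (hφ : ContinuousOn φ K) : Integrable φ η := by
  have h1 : IntegrableOn φ K η := hφ.integrableOn_compact hK
  have h2 : η.restrict K = η := Measure.restrict_eq_self_of_ae_mem (mem_ae_iff.2 hη)
  rwa [IntegrableOn, h2] at h1

section SignedIntegral

variable {d : ℕ} {K : Set (Space d)} {m : SignedMeasure (Space d)}

theorem posPart_eq_zero_of_totalVariation {A : Set (Space d)} (h : m.totalVariation A = 0) :
    m.toJordanDecomposition.posPart A = 0 := by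
  rw [SignedMeasure.totalVariation, Measure.add_apply] at h
  exact (add_eq_zero.1 h).1

theorem negPart_eq_zero_of_totalVariation {A : Set (Space d)} (h : m.totalVariation A = 0) :
    m.toJordanDecomposition.negPart A = 0 := by
  rw [SignedMeasure.totalVariation, Measure.add_apply] at h
  exact (add_eq_zero.1 h).2

theorem ae_posPart_mem (h : m.totalVariation Kᶜ = 0) :
    ∀ᵐ x ∂m.toJordanDecomposition.posPart, x ∈ K :=
  mem_ae_iff.2 (posPart_eq_zero_of_totalVariation h)

theorem ae_negPart_mem (h : m.totalVariation Kᶜ = 0) :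
    ∀ᵐ x ∂m.toJordanDecomposition.negPart, x ∈ K :=
  mem_ae_iff.2 (negPart_eq_zero_of_totalVariation h)

theorem abs_signedIntegral_le (h : m.totalVariation Kᶜ = 0) {φ : Space d → ℝ} {c : ℝ}
    (hφ : ∀ x ∈ K, |φ x| ≤ c) :
    |signedIntegral m φ| ≤ c * (m.totalVariation univ).toReal := by
  have h1 : |∫ x, φ x ∂m.toJordanDecomposition.posPart|
      ≤ c * m.toJordanDecomposition.posPart.real univ := by
    rw [← Real.norm_eq_abs]
    exact norm_integral_le_of_norm_le_const ((ae_posPart_mem h).mono hφ)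
  have h2 : |∫ x, φ x ∂m.toJordanDecomposition.negPart|
      ≤ c * m.toJordanDecomposition.negPart.real univ := by
    rw [← Real.norm_eq_abs]
    exact norm_integral_le_of_norm_le_const ((ae_negPart_mem h).mono hφ)
  rw [SignedMeasure.totalVariation, Measure.add_apply,
    ENNReal.toReal_add (measure_ne_top _ _) (measure_ne_top _ _), mul_add]
  exact (abs_sub _ _).trans (add_le_add h1 h2)

theorem signedIntegral_congr (h : m.totalVariation Kᶜ = 0) {φ ψ : Space d → ℝ}
    (hφ : EqOn φ ψ K) : signedIntegral m φ = signedIntegral m ψ := by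
  rw [signedIntegral, signedIntegral, integral_congr_ae ((ae_posPart_mem h).mono hφ),
    integral_congr_ae ((ae_negPart_mem h).mono hφ)]

theorem signedIntegral_const_mul (c : ℝ) (φ : Space d → ℝ) :
    signedIntegral m (fun x => c * φ x) = c * signedIntegral m φ := by
  rw [signedIntegral, signedIntegral, integral_const_mul, integral_const_mul, mul_sub]

theorem signedIntegral_sub (hK : IsCompact K) (h : m.totalVariation Kᶜ = 0) {φ ψ : Space d → ℝ}
    (hφ : ContinuousOn φ K) (hψ : ContinuousOn ψ K) :
    signedIntegral m (fun x => φ x - ψ x) = signedIntegral m φ - signedIntegral m ψ := by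
  have hp := posPart_eq_zero_of_totalVariation h
  have hn := negPart_eq_zero_of_totalVariation h
  rw [signedIntegral, signedIntegral, signedIntegral,
    integral_sub (integrable_of_compact_carrier hK hp hφ) (integrable_of_compact_carrier hK hp hψ),
    integral_sub (integrable_of_compact_carrier hK hn hφ) (integrable_of_compact_carrier hK hn hψ)]
  ring

theorem signedIntegral_add (hK : IsCompact K) (h : m.totalVariation Kᶜ = 0) {φ ψ : Space d → ℝ}
    (hφ : ContinuousOn φ K) (hψ : ContinuousOn ψ K) :
    signedIntegral m (fun x => φ x + ψ x) = signedIntegral m φ + signedIntegral m ψ := by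
  have hp := posPart_eq_zero_of_totalVariation h
  have hn := negPart_eq_zero_of_totalVariation h
  rw [signedIntegral, signedIntegral, signedIntegral,
    integral_add (integrable_of_compact_carrier hK hp hφ) (integrable_of_compact_carrier hK hp hψ),
    integral_add (integrable_of_compact_carrier hK hn hφ) (integrable_of_compact_carrier hK hn hψ)]
  ring

theorem signedIntegral_zero (φ : Space d → ℝ) :
    signedIntegral (0 : SignedMeasure (Space d)) φ = 0 := by
  simp [signedIntegral, SignedMeasure.toJordanDecomposition_zero]

theorem signedIntegral_mono {m' : SignedMeasure (Space d)} (hm : m' ≤ m) (hK : IsCompact K)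
    (h : m.totalVariation Kᶜ = 0) (h' : m'.totalVariation Kᶜ = 0) {φ : Space d → ℝ}
    (hφ : ContinuousOn φ K) (hφ0 : ∀ x, 0 ≤ φ x) :
    signedIntegral m' φ ≤ signedIntegral m φ := by
  have hp := integrable_of_compact_carrier hK (posPart_eq_zero_of_totalVariation h) hφ
  have hn := integrable_of_compact_carrier hK (negPart_eq_zero_of_totalVariation h) hφ
  have hp' := integrable_of_compact_carrier hK (posPart_eq_zero_of_totalVariation h') hφ
  have hn' := integrable_of_compact_carrier hK (negPart_eq_zero_of_totalVariation h') hφ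
  -- The Jordan parts of ordered signed measures need not be compared separately: moving the
  -- negative parts across leaves an inequality of non-negative measures.
  have hle : m'.toJordanDecomposition.posPart + m.toJordanDecomposition.negPart
      ≤ m.toJordanDecomposition.posPart + m'.toJordanDecomposition.negPart := by
    rw [Measure.le_iff]
    intro A hA
    have := hm A hA
    rw [SignedMeasure.apply_eq_posPart_real_sub_negPart_real _ hA,
      SignedMeasure.apply_eq_posPart_real_sub_negPart_real _ hA] at this
    rw [Measure.add_apply, Measure.add_apply, ← ENNReal.toReal_le_toReal
      (ENNReal.add_ne_top.2 ⟨measure_ne_top _ _, measure_ne_top _ _⟩)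
      (ENNReal.add_ne_top.2 ⟨measure_ne_top _ _, measure_ne_top _ _⟩),
      ENNReal.toReal_add (measure_ne_top _ _) (measure_ne_top _ _),
      ENNReal.toReal_add (measure_ne_top _ _) (measure_ne_top _ _)]
    simp only [Measure.real] at this
    linarith
  have := integral_mono_measure hle (ae_of_all _ hφ0) (hp.add_measure hn')
  rw [integral_add_measure hp' hn, integral_add_measure hp hn'] at this
  rw [signedIntegral, signedIntegral]
  linarith

theorem tendsto_signedIntegral {A : Set (Space d)} (h : m.totalVariation Aᶜ = 0)
    {φ : ℕ → Space d → ℝ} {ψ : Space d → ℝ} (hφ : ∀ n, Continuous (φ n)) {C : ℝ}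
    (hC : ∀ n, ∀ x ∈ A, |φ n x| ≤ C) (hlim : ∀ x ∈ A, Tendsto (fun n => φ n x) atTop (𝓝 (ψ x))) :
    Tendsto (fun n => signedIntegral m (φ n)) atTop (𝓝 (signedIntegral m ψ)) := by
  refine Tendsto.sub ?_ ?_
  · refine tendsto_integral_of_dominated_convergence (fun _ => C)
      (fun n => (hφ n).aestronglyMeasurable) (integrable_const _) (fun n => ?_)
      ((ae_posPart_mem h).mono hlim)
    exact (ae_posPart_mem h).mono (hC n)
  · refine tendsto_integral_of_dominated_convergence (fun _ => C)
      (fun n => (hφ n).aestronglyMeasurable) (integrable_const _) (fun n => ?_)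
      ((ae_negPart_mem h).mono hlim)
    exact (ae_negPart_mem h).mono (hC n)

end SignedIntegral

/-! ### Mollification, cut-offs, approximation by test functions -/

/-- A mollification is an average of translates, so it keeps the Lipschitz constant; keeping it
exactly is what later bounds the gradient by `1`. -/
theorem exists_contDiff_lipschitz_approx {d : ℕ} {C : ℝ≥0} {v : Space d → ℝ}
    (hv : LipschitzWith C v) {ε : ℝ} (hε : 0 < ε) :
    ∃ g : Space d → ℝ, ContDiff ℝ ∞ g ∧ LipschitzWith C g ∧ ∀ x, |g x - v x| ≤ ε := by
  obtain ⟨r, hr, hrv⟩ := Metric.uniformContinuous_iff.1 hv.uniformContinuous ε hε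
  let ρ : ContDiffBump (0 : Space d) := ⟨r / 2, r, half_pos hr, half_lt_self hr⟩
  have hint : ∀ x, Integrable (fun t => ρ.normed volume t * v (x - t)) := fun x =>
    (ρ.continuous_normed.mul (hv.continuous.comp (by fun_prop))).integrable_of_hasCompactSupport
      ρ.hasCompactSupport_normed.mul_right
  refine ⟨convolution (ρ.normed volume) v (ContinuousLinearMap.lsmul ℝ ℝ) volume,
    ρ.hasCompactSupport_normed.contDiff_convolution_left _ ρ.contDiff_normed
      hv.continuous.locallyIntegrable, ?_, fun x => ?_⟩
  · refine LipschitzWith.of_dist_le_mul fun x y => ?_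
    simp only [convolution_def, ContinuousLinearMap.lsmul_apply, smul_eq_mul]
    rw [Real.dist_eq, ← integral_sub (hint x) (hint y), ← Real.norm_eq_abs]
    calc ‖∫ t, (ρ.normed volume t * v (x - t) - ρ.normed volume t * v (y - t))‖
        ≤ ∫ t, ρ.normed volume t * (C * dist x y) := by
          refine norm_integral_le_of_norm_le (ρ.integrable_normed.mul_const _)
            (ae_of_all _ fun t => ?_)
          rw [← mul_sub, norm_mul, Real.norm_of_nonneg (ρ.nonneg_normed t), ← dist_eq_norm]
          refine mul_le_mul_of_nonneg_left ?_ (ρ.nonneg_normed t)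
          simpa using hv.dist_le_mul (x - t) (y - t)
      _ = C * dist x y := by rw [integral_mul_const, ρ.integral_normed, one_mul]
  · rw [← Real.dist_eq]
    exact ρ.dist_normed_convolution_le hv.continuous.aestronglyMeasurable
      fun y hy => (hrv hy).le

/-- Being `1` in a neighbourhood of each point of `K`, the cut-off alters neither values nor
gradients on `K`. -/
theorem exists_cutoff {d : ℕ} {K U : Set (Space d)} (hK : IsCompact K) (hU : IsOpen U)
    (hKU : K ⊆ U) :
    ∃ χ : Space d → ℝ, IsTestFunction U χ ∧ (∀ x, 0 ≤ χ x ∧ χ x ≤ 1) ∧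
      ∀ x ∈ K, χ =ᶠ[𝓝 x] fun _ => 1 := by
  obtain ⟨K₁, hK₁, h₁, h₁U⟩ := exists_compact_between hK hU hKU
  obtain ⟨K₂, hK₂, h₂, h₂U⟩ := exists_compact_between hK₁ hU h₁U
  obtain ⟨χ, hχ, hr, hs, h1⟩ := exists_contMDiff_support_eq_eq_one_iff
    (modelWithCornersSelf ℝ (Space d)) (n := ⊤) isOpen_interior hK₁.isClosed h₂
  have hsub : tsupport χ ⊆ K₂ := by
    rw [tsupport, hs]
    exact closure_minimal interior_subset hK₂.isClosed
  refine ⟨χ, ⟨hχ.contDiff, hK₂.of_isClosed_subset (isClosed_tsupport _) hsub, hsub.trans h₂U⟩,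
    fun x => hr (mem_range_self x), fun x hx => ?_⟩
  filter_upwards [isOpen_interior.mem_nhds (h₁ hx)] with y hy
  exact (h1 y).1 (interior_subset hy)

theorem IsTestFunction.mul {d : ℕ} {U : Set (Space d)} {χ g : Space d → ℝ}
    (hχ : IsTestFunction U χ) (hg : ContDiff ℝ ∞ g) : IsTestFunction U (fun x => χ x * g x) :=
  ⟨hχ.smooth.mul hg, hχ.compact.mul_right, (tsupport_mul_subset_left).trans hχ.support⟩

/-- A Lipschitz function is the boundedly pointwise limit on a bounded open set of
test functions supported in it. -/
theorem exists_testFunction_tendsto {d : ℕ} {Ω : Set (Space d)} (hΩ : IsOpen Ω)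
    (hb : Bornology.IsBounded Ω) {C : ℝ≥0} {φ : Space d → ℝ} (hφ : LipschitzWith C φ) :
    ∃ (φn : ℕ → Space d → ℝ) (B : ℝ), (∀ n, IsTestFunction Ω (φn n)) ∧
      (∀ n x, |φn n x| ≤ B) ∧ ∀ x ∈ Ω, Tendsto (fun n => φn n x) atTop (𝓝 (φ x)) := by
  -- Mollifications are multiplied by cut-offs along a compact exhaustion of `Ω`. The gradients are
  -- not controlled, but only bounded pointwise convergence is wanted.
  obtain ⟨F, hFc, hFΩ, hFU, hFm⟩ := hΩ.exists_iUnion_isClosed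
  have hcpt : ∀ n, IsCompact (F n) := fun n =>
    Metric.isCompact_of_isClosed_isBounded (hFc n) (hb.subset (hFΩ n))
  choose χ hχ hχ01 hχ1 using fun n => exists_cutoff (hcpt n) hΩ (hFΩ n)
  choose g hg _ hgφ using fun n : ℕ =>
    exists_contDiff_lipschitz_approx hφ (ε := 1 / ((n : ℝ) + 1)) (by positivity)
  obtain ⟨B, hB⟩ := hb.isCompact_closure.exists_bound_of_continuousOn hφ.continuous.continuousOn
  have hg1 : ∀ n x, |g n x - φ x| ≤ 1 := fun n x => (hgφ n x).trans <| by
    rw [div_le_one (by positivity)]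
    linarith [(Nat.cast_nonneg n : (0 : ℝ) ≤ n)]
  refine ⟨fun n x => χ n x * g n x, |B| + 1, fun n => (hχ n).mul (hg n), fun n x => ?_,
    fun x hx => ?_⟩
  · by_cases hx : x ∈ Ω
    · have h1 : |g n x| ≤ |B| + 1 := by
        have h2 := hB x (subset_closure hx)
        rw [Real.norm_eq_abs] at h2
        have h3 := abs_sub_abs_le_abs_sub (g n x) (φ x)
        linarith [hg1 n x, le_abs_self B]
      rw [abs_mul, abs_of_nonneg (hχ01 n x).1]
      calc χ n x * |g n x| ≤ 1 * |g n x| :=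
            mul_le_mul_of_nonneg_right (hχ01 n x).2 (abs_nonneg _)
        _ ≤ |B| + 1 := by rwa [one_mul]
    · have : χ n x = 0 := by
        by_contra h
        exact hx ((hχ n).support (subset_tsupport _ h))
      simp only [this, zero_mul, abs_zero]
      positivity
  · rw [← hFU, mem_iUnion] at hx
    obtain ⟨N, hN⟩ := hx
    have hgl : Tendsto (fun n => g n x) atTop (𝓝 (φ x)) := by
      rw [tendsto_iff_dist_tendsto_zero]
      exact squeeze_zero (fun _ => dist_nonneg) (fun n => by rw [Real.dist_eq]; exact hgφ n x)
        tendsto_one_div_add_atTop_nhds_zero_nat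
    refine hgl.congr' ?_
    filter_upwards [eventually_ge_atTop N] with n hn
    rw [(hχ1 n x (hFm hn hN)).eq_of_nhds, one_mul]

/-! ### From the bound on the weak gradient to the Lipschitz bound -/

theorem norm_gradient {d : ℕ} {φ : Space d → ℝ} {x : Space d} :
    ‖gradient φ x‖ = ‖fderiv ℝ φ x‖ := by
  simp [gradient]

theorem continuous_gradient {d : ℕ} {φ : Space d → ℝ} (hφ : ContDiff ℝ ∞ φ) :
    Continuous (gradient φ) :=
  (InnerProductSpace.toDual ℝ (Space d)).symm.continuous.comp (hφ.continuous_fderiv (by simp))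

/-- When the ball lies in `Ω`, the kernel centred at `p` is admissible in the integration by parts,
so the gradient of the mollification is the average of `G` against a probability density. The
extension of `v` by zero is not seen at `p`. -/
theorem norm_fderiv_convolution_le {d : ℕ} {Ω : Set (Space d)} {v : Space d → ℝ}
    {G : Space d → Space d} (hΩ : IsOpen Ω) (hv : IntegrableOn v Ω)
    (h : HasWeakGradient Ω v G) (hG : ∀ᵐ x ∂volume.restrict Ω, ‖G x‖ ≤ 1)
    (ρ : ContDiffBump (0 : Space d)) {p : Space d} (hp : Metric.closedBall p ρ.rOut ⊆ Ω) :
    ∃ D : Space d →L[ℝ] ℝ, HasFDerivAt (convolution (ρ.normed volume) (Ω.indicator v)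
      (ContinuousLinearMap.lsmul ℝ ℝ) volume) D p ∧ ‖D‖ ≤ 1 := by
  have hvi : LocallyIntegrable (Ω.indicator v) volume :=
    ((integrable_indicator_iff hΩ.measurableSet).2 hv).locallyIntegrable
  have hρ1 : ContDiff ℝ 1 (ρ.normed (volume : Measure (Space d))) := ρ.contDiff_normed (n := 1)
  refine ⟨_, ρ.hasCompactSupport_normed.hasFDerivAt_convolution_left _ hρ1 hvi p, ?_⟩
  let Φ : Space d → ℝ := fun q => ρ.normed volume (p - q)
  have hΦsupp : tsupport Φ ⊆ Metric.closedBall p ρ.rOut := by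
    refine closure_minimal (fun q hq => ?_) Metric.isClosed_closedBall
    have : p - q ∈ Function.support (ρ.normed (volume : Measure (Space d))) := hq
    rw [ρ.support_normed_eq, mem_ball_zero_iff] at this
    rw [mem_closedBall_iff_norm']
    exact this.le
  have hΦ : IsTestFunction Ω Φ :=
    ⟨ρ.contDiff_normed.comp (contDiff_const.sub contDiff_id),
      (isCompact_closedBall p ρ.rOut).of_isClosed_subset (isClosed_tsupport _) hΦsupp,
      hΦsupp.trans hp⟩
  have hΦ1 : ∫ q, Φ q = 1 := by
    rw [integral_sub_left_eq_self (ρ.normed volume), ρ.integral_normed]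
  have hΦi : Integrable Φ := hΦ.smooth.continuous.integrable_of_hasCompactSupport hΦ.compact
  have hΦ0 : ∀ q, 0 ≤ Φ q := fun q => ρ.nonneg_normed _
  have hnorm : ‖∫ q in Ω, Φ q • G q‖ ≤ 1 := by
    calc ‖∫ q in Ω, Φ q • G q‖ ≤ ∫ q in Ω, Φ q := by
          refine norm_integral_le_of_norm_le hΦi.integrableOn ?_
          filter_upwards [hG] with q hq
          rw [norm_smul, Real.norm_of_nonneg (hΦ0 q)]
          exact mul_le_of_le_one_right (hΦ0 q) hq
      _ ≤ ∫ q, Φ q := setIntegral_le_integral hΦi (ae_of_all _ hΦ0)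
      _ = 1 := hΦ1
  refine ContinuousLinearMap.opNorm_le_bound _ zero_le_one fun e => ?_
  have hfd : ∀ q, fderiv ℝ Φ q e = - fderiv ℝ (ρ.normed volume) (p - q) e := by
    intro q
    have h1 : HasFDerivAt (ρ.normed volume) (fderiv ℝ (ρ.normed volume) (p - q)) (p - q) :=
      (hρ1.differentiable one_ne_zero _).hasFDerivAt
    have h2 : HasFDerivAt (fun q : Space d => p - q) (-(ContinuousLinearMap.id ℝ (Space d))) q := by
      simpa using (hasFDerivAt_id q).const_sub p
    have h3 := (h1.comp q h2).fderiv
    change fderiv ℝ Φ q = _ at h3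
    rw [h3]
    simp
  have hgi : IntegrableOn (fun q => v q • gradient Φ q) Ω := by
    have hgc : HasCompactSupport (gradient Φ) := by
      refine HasCompactSupport.comp_left (hΦ.compact.fderiv (𝕜 := ℝ)) (map_zero _)
    obtain ⟨B, hB⟩ := (continuous_gradient hΦ.smooth).bounded_above_of_compact_support hgc
    exact hv.smul_bdd B (continuous_gradient hΦ.smooth).aestronglyMeasurable (ae_of_all _ hB)
  have key : (convolution (fderiv ℝ (ρ.normed volume)) (Ω.indicator v)
      ((ContinuousLinearMap.lsmul ℝ ℝ).precompL (Space d)) volume p) e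
      = inner ℝ (∫ q in Ω, Φ q • G q) e := by
    have hce := (ρ.hasCompactSupport_normed.fderiv (𝕜 := ℝ)).convolutionExists_left
      ((ContinuousLinearMap.lsmul ℝ ℝ).precompL (Space d)) (hρ1.continuous_fderiv one_ne_zero)
      hvi p
    rw [convolution_def, ContinuousLinearMap.integral_apply hce]
    have h4 : ∫ q in Ω, Φ q • G q = - ∫ q in Ω, v q • gradient Φ q := by
      rw [h.byParts Φ hΦ, neg_neg]
    rw [h4, inner_neg_left, real_inner_comm, ← integral_inner hgi,
      ← integral_sub_left_eq_self _ volume p, ← integral_neg, ← integral_indicator hΩ.measurableSet]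
    refine integral_congr_ae (ae_of_all _ fun q => ?_)
    by_cases hq : q ∈ Ω
    · simp only [indicator_of_mem hq, sub_sub_cancel, inner_smul_right]
      simp [mul_comm, hfd]
    · simp [hq]
  rw [key]
  exact (norm_inner_le_norm _ _).trans (mul_le_mul_of_nonneg_right hnorm (norm_nonneg _))

/-- Convexity puts the segment between two points inside `Ω`, at positive distance from the
complement. Mollifications at a smaller scale obey the mean value inequality along it. -/
theorem lipschitzOnWith_of_hasWeakGradient {d : ℕ} {Ω : Set (Space d)} {v : Space d → ℝ}
    {G : Space d → Space d} (hΩ : IsOpen Ω) (hconv : Convex ℝ Ω) (hb : Bornology.IsBounded Ω)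
    (hv : ContinuousOn v (closure Ω)) (h : HasWeakGradient Ω v G)
    (hG : ∀ᵐ x ∂volume.restrict Ω, ‖G x‖ ≤ 1) : LipschitzOnWith 1 v (closure Ω) := by
  refine LipschitzOnWith.closure hv (LipschitzOnWith.of_dist_le_mul fun x hx y hy => ?_)
  rw [NNReal.coe_one, one_mul]
  have hvi : IntegrableOn v Ω :=
    (hv.integrableOn_compact hb.isCompact_closure).mono_set subset_closure
  have hseg : segment ℝ x y ⊆ Ω := hconv.segment_subset hx hy
  have hsegc : IsCompact (segment ℝ x y) := by
    rw [segment_eq_image]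
    exact isCompact_Icc.image (by fun_prop)
  obtain ⟨δ, hδ, hδΩ⟩ := hsegc.exists_cthickening_subset_open hΩ hseg
  refine le_of_forall_pos_le_add fun ε hε => ?_
  have hnear : ∀ z ∈ Ω, ∃ r > 0, ∀ q ∈ Metric.ball z r, dist (Ω.indicator v q)
      (Ω.indicator v z) ≤ ε / 2 := by
    intro z hz
    have hc : ContinuousAt (Ω.indicator v) z := by
      refine (hv.continuousAt (mem_of_superset (hΩ.mem_nhds hz) subset_closure)).congr ?_
      filter_upwards [hΩ.mem_nhds hz] with q hq
      rw [indicator_of_mem hq]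
    obtain ⟨r, hr, h'⟩ := Metric.continuousAt_iff.1 hc (ε / 2) (half_pos hε)
    exact ⟨r, hr, fun q hq => (h' hq).le⟩
  obtain ⟨r₁, hr₁, hx₁⟩ := hnear x hx
  obtain ⟨r₂, hr₂, hy₂⟩ := hnear y hy
  have hr : 0 < min δ (min r₁ r₂) := lt_min hδ (lt_min hr₁ hr₂)
  -- The radius `δ` keeps the kernels along the segment inside `Ω`; `r₁` and `r₂` make the
  -- mollification `ε / 2`-close to `v` at the endpoints.
  let ρ : ContDiffBump (0 : Space d) := ⟨_, min δ (min r₁ r₂), half_pos hr, half_lt_self hr⟩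
  set F := convolution (ρ.normed volume) (Ω.indicator v) (ContinuousLinearMap.lsmul ℝ ℝ) volume
    with hF
  have hm : AEStronglyMeasurable (Ω.indicator v) volume :=
    ((integrable_indicator_iff hΩ.measurableSet).2 hvi).aestronglyMeasurable
  have hFx : dist (F x) (v x) ≤ ε / 2 := by
    rw [← indicator_of_mem hx v]
    exact ρ.dist_normed_convolution_le hm fun q hq => hx₁ q
      (Metric.ball_subset_ball ((min_le_right _ _).trans (min_le_left _ _)) hq)
  have hFy : dist (F y) (v y) ≤ ε / 2 := by
    rw [← indicator_of_mem hy v]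
    exact ρ.dist_normed_convolution_le hm fun q hq => hy₂ q
      (Metric.ball_subset_ball ((min_le_right _ _).trans (min_le_right _ _)) hq)
  have hD : ∀ p ∈ segment ℝ x y, ∃ D : Space d →L[ℝ] ℝ, HasFDerivAt F D p ∧ ‖D‖ ≤ 1 := by
    intro p hp
    refine norm_fderiv_convolution_le hΩ hvi h hG ρ fun q hq => hδΩ ?_
    refine Metric.closedBall_subset_cthickening hp δ ?_
    exact Metric.closedBall_subset_closedBall (min_le_left _ _) hq
  have hFxy : dist (F x) (F y) ≤ dist x y := by
    choose! D hD1 hD2 using hD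
    have := (convex_segment x y).norm_image_sub_le_of_norm_hasFDerivWithin_le
      (fun p hp => (hD1 p hp).hasFDerivWithinAt) hD2 (right_mem_segment ℝ x y)
      (left_mem_segment ℝ x y)
    rwa [one_mul, ← dist_eq_norm, ← dist_eq_norm] at this
  have h1 := dist_triangle4 (v x) (F x) (F y) (v y)
  rw [dist_comm (v x) (F x)] at h1
  linarith

/-! ### Joint continuity in space and time -/

/-- Finitely many balls of radius `r / 2` cover the closure, and every ball of radius `r` centred
there contains one of them. -/
theorem exists_ball_measure_lower_bound {d : ℕ} {Ω : Set (Space d)} (hΩ : IsOpen Ω)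
    (hb : Bornology.IsBounded Ω) {r : ℝ} (hr : 0 < r) :
    ∃ c : ENNReal, c ≠ 0 ∧ ∀ x ∈ closure Ω, c ≤ volume (Metric.ball x r ∩ Ω) := by
  obtain ⟨s, hs, hcov⟩ := hb.isCompact_closure.elim_nhds_subcover
    (fun x => Metric.ball x (r / 2)) (fun x _ => Metric.ball_mem_nhds x (half_pos hr))
  refine ⟨s.inf fun x => volume (Metric.ball x (r / 2) ∩ Ω), ?_, fun x hx => ?_⟩
  · rw [← pos_iff_ne_zero, Finset.lt_inf_iff (by simp)]
    intro x hx
    refine (Metric.isOpen_ball.inter hΩ).measure_pos _ ?_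
    exact mem_closure_iff.1 (hs x hx) _ Metric.isOpen_ball (Metric.mem_ball_self (half_pos hr))
  · obtain ⟨y, hy, hxy⟩ := mem_iUnion₂.1 (hcov hx)
    refine (Finset.inf_le hy).trans (measure_mono (inter_subset_inter_left _ ?_))
    refine Metric.ball_subset_ball' ?_
    rw [dist_comm]
    linarith [Metric.mem_ball.1 hxy]

/-- For functions with a common Lipschitz constant, convergence in `L²` implies uniform
convergence. -/
theorem exists_eLpNorm_lt_imp_abs_lt {d : ℕ} {Ω : Set (Space d)} (hΩ : IsOpen Ω)
    (hb : Bornology.IsBounded Ω) {ε : ℝ} (hε : 0 < ε) :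
    ∃ η : ENNReal, 0 < η ∧ ∀ w : Space d → ℝ, LipschitzOnWith 2 w (closure Ω) →
      eLpNorm w 2 (volume.restrict Ω) < η → ∀ x ∈ closure Ω, |w x| < ε := by
  obtain ⟨c, hc0, hc⟩ := exists_ball_measure_lower_bound hΩ hb (r := ε / 4) (by positivity)
  -- If `|w x| ≥ ε`, the Lipschitz constant `2` forces `|w| ≥ ε / 2` on the ball of radius `ε / 4`,
  -- so the `L²` norm is at least `(ε / 2) c^(1/2)`.
  refine ⟨ENNReal.ofReal (ε / 2) * c ^ (1 / (2 : ℝ)), ?_, fun w hw hlt x hx => ?_⟩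
  · refine ENNReal.mul_pos (by simpa using hε) ?_
    intro h
    rw [ENNReal.rpow_eq_zero_iff] at h
    rcases h with h | h
    · exact hc0 h.1
    · norm_num at h
  by_contra hge
  rw [not_lt] at hge
  have hball : MeasurableSet (Metric.ball x (ε / 4) ∩ Ω) :=
    (Metric.isOpen_ball.inter hΩ).measurableSet
  have hbd : ∀ y ∈ Metric.ball x (ε / 4) ∩ Ω, ε / 2 ≤ ‖w y‖ := by
    intro y hy
    have h1 := hw.dist_le_mul x hx y (subset_closure hy.2)
    have h2 := Metric.mem_ball'.1 hy.1
    rw [Real.dist_eq, NNReal.coe_ofNat] at h1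
    have h3 := abs_sub_abs_le_abs_sub (w x) (w y)
    rw [Real.norm_eq_abs]
    linarith
  have h1 : eLpNorm (fun _ : Space d => ε / 2) 2 (volume.restrict (Metric.ball x (ε / 4) ∩ Ω))
      ≤ eLpNorm w 2 (volume.restrict Ω) := by
    refine (eLpNorm_mono_ae ?_).trans (eLpNorm_mono_measure w
      (Measure.restrict_mono inter_subset_right le_rfl))
    filter_upwards [ae_restrict_mem hball] with y hy
    rw [Real.norm_of_nonneg (by positivity)]
    exact hbd y hy
  rw [eLpNorm_const' _ (by norm_num) (by norm_num), Measure.restrict_apply_univ] at h1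
  refine absurd (h1.trans_lt hlt) (not_lt.2 ?_)
  rw [← ofReal_norm, Real.norm_of_nonneg (by positivity)]
  gcongr
  · norm_num
    exact ENNReal.rpow_le_rpow (hc x hx) (by norm_num)

section Time

variable {d : ℕ} {T : ℝ} {Ω : Set (Space d)} {u : ℝ → Space d → ℝ}

theorem ae_timeMeasure_iff {p : ℝ → Prop} :
    (∀ᵐ t ∂timeMeasure T, p t) ↔ ∀ᵐ t, t ∈ Ioo 0 T → p t :=
  ae_restrict_iff' measurableSet_Ioo

theorem exists_near_of_ae_timeMeasure (hT : 0 < T) {p : ℝ → Prop}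
    (hp : ∀ᵐ t ∂timeMeasure T, p t) {t : ℝ} (ht : t ∈ Icc 0 T) :
    ∃ s : ℕ → ℝ, (∀ n, s n ∈ Ioo 0 T ∧ p (s n)) ∧ Tendsto s atTop (𝓝 t) := by
  have hcl : t ∈ closure {s | s ∈ Ioo 0 T ∧ p s} := by
    have h1 : t ∈ closure (Ioo 0 T) := by rwa [closure_Ioo hT.ne]
    rw [Metric.mem_closure_iff] at h1 ⊢
    intro ε hε
    obtain ⟨b, hb, htb⟩ := h1 ε hε
    have hopen : IsOpen (Ioo 0 T ∩ Metric.ball t ε) := isOpen_Ioo.inter Metric.isOpen_ball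
    have hpos : volume (Ioo 0 T ∩ Metric.ball t ε) ≠ 0 :=
      (hopen.measure_pos volume ⟨b, hb, Metric.mem_ball'.2 htb⟩).ne'
    by_contra! hno
    refine hpos (measure_mono_null ?_ (ae_timeMeasure_iff.1 hp))
    intro s hs hps
    have := hno s ⟨hs.1, hps hs.1⟩
    exact absurd (Metric.mem_ball'.1 hs.2) (not_lt.2 this)
  exact mem_closure_iff_seq_limit.1 hcl

/-- Any time is a limit of good times. `L²` convergence gives a.e. convergence along a subsequence,
so the bound passes to a dense set of points, then to the closure by continuity. -/
theorem lipschitzOnWith_of_ae (hΩ : IsOpen Ω) (hT : 0 < T)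
    (hcont : ∀ t ∈ Icc 0 T, ContinuousOn (u t) (closure Ω))
    (htime : ∀ t ∈ Icc 0 T, Tendsto (fun s => eLpNorm (fun x => u s x - u t x) 2
      (volume.restrict Ω)) (𝓝[Icc 0 T] t) (𝓝 0))
    (hlip : ∀ᵐ t ∂timeMeasure T, LipschitzOnWith 1 (u t) (closure Ω)) :
    ∀ t ∈ Icc 0 T, LipschitzOnWith 1 (u t) (closure Ω) := by
  intro t ht
  obtain ⟨s, hs, hst⟩ := exists_near_of_ae_timeMeasure hT hlip ht
  have hmeas : ∀ t ∈ Icc 0 T, AEStronglyMeasurable (u t) (volume.restrict Ω) := fun t ht =>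
    ((hcont t ht).mono subset_closure).aestronglyMeasurable hΩ.measurableSet
  have hs' : ∀ n, s n ∈ Icc 0 T := fun n => Ioo_subset_Icc_self (hs n).1
  have hL2 : Tendsto (fun n => eLpNorm (u (s n) - u t) 2 (volume.restrict Ω)) atTop (𝓝 0) :=
    (htime t ht).comp (tendsto_nhdsWithin_iff.2 ⟨hst, Eventually.of_forall hs'⟩)
  have hmeasure := tendstoInMeasure_of_tendsto_eLpNorm two_ne_zero (fun n => hmeas _ (hs' n))
    (hmeas t ht) hL2
  obtain ⟨k, -, hk⟩ := hmeasure.exists_seq_tendsto_ae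
  have hdense : Ω ⊆ closure (Ω ∩ {x | Tendsto (fun n => u (s (k n)) x) atTop (𝓝 (u t x))}) := by
    intro x hx
    rw [mem_closure_iff]
    intro o ho hxo
    have hpos : volume (o ∩ Ω) ≠ 0 := ((ho.inter hΩ).measure_pos volume ⟨x, hxo, hx⟩).ne'
    rw [ae_restrict_iff' hΩ.measurableSet] at hk
    by_contra hno
    rw [not_nonempty_iff_eq_empty] at hno
    refine hpos (measure_mono_null ?_ hk)
    intro y hy hyk
    have : y ∈ o ∩ (Ω ∩ {x | Tendsto (fun n => u (s (k n)) x) atTop (𝓝 (u t x))}) :=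
      ⟨hy.1, hy.2, hyk hy.2⟩
    rw [hno] at this
    exact this
  have hlipD : LipschitzOnWith 1 (u t)
      (Ω ∩ {x | Tendsto (fun n => u (s (k n)) x) atTop (𝓝 (u t x))}) := by
    refine LipschitzOnWith.of_dist_le_mul fun x hx y hy => ?_
    refine le_of_tendsto (hx.2.dist hy.2) (Eventually.of_forall fun n => ?_)
    exact (hs (k n)).2.dist_le_mul x (subset_closure hx.1) y (subset_closure hy.1)
  refine (LipschitzOnWith.closure ((hcont t ht).mono ?_) hlipD).mono ?_
  · exact closure_mono inter_subset_left
  · exact closure_minimal hdense isClosed_closure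

/-- Differences of two time slices are `2`-Lipschitz, so continuity in `L²` is continuity in the
uniform norm. -/
theorem continuousOn_uncurry_of_lipschitz (hΩ : IsOpen Ω) (hb : Bornology.IsBounded Ω)
    (htime : ∀ t ∈ Icc 0 T, Tendsto (fun s => eLpNorm (fun x => u s x - u t x) 2
      (volume.restrict Ω)) (𝓝[Icc 0 T] t) (𝓝 0))
    (hlip : ∀ t ∈ Icc 0 T, LipschitzOnWith 1 (u t) (closure Ω)) :
    ContinuousOn (fun p : ℝ × Space d => u p.1 p.2) (Icc 0 T ×ˢ closure Ω) := by
  rintro ⟨t, x⟩ ⟨ht, hx⟩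
  rw [ContinuousWithinAt, Metric.tendsto_nhds]
  intro ε hε
  obtain ⟨η, hη, hηw⟩ := exists_eLpNorm_lt_imp_abs_lt hΩ hb (half_pos hε)
  rw [nhdsWithin_prod_eq]
  have h1 := ((htime t ht).eventually (gt_mem_nhds hη)).and self_mem_nhdsWithin
  have h2 : ∀ᶠ y in 𝓝[closure Ω] x, y ∈ Metric.ball x (ε / 2) ∧ y ∈ closure Ω :=
    inter_mem (mem_nhdsWithin_of_mem_nhds (Metric.ball_mem_nhds x (half_pos hε)))
      self_mem_nhdsWithin
  filter_upwards [h1.prod_mk h2] with ⟨s, y⟩ ⟨⟨hs, hsI⟩, hy, hyΩ⟩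
  have hw : LipschitzOnWith 2 (fun x => u s x - u t x) (closure Ω) := by
    have := (hlip s hsI).sub (hlip t ht)
    rwa [one_add_one_eq_two] at this
  have h3 := hηw _ hw hs y hyΩ
  have h4 := (hlip t ht).dist_le_mul y hyΩ x hx
  rw [NNReal.coe_one, one_mul] at h4
  have h5 := dist_triangle (u s y) (u t y) (u t x)
  rw [← Real.dist_eq] at h3
  have h6 := Metric.mem_ball.1 hy
  change dist (u s y) (u t x) < ε
  linarith

end Time

/-! ### Smooth steps and primitives of distributional derivatives -/

section SmoothStep

/-- A smooth function that vanishes to the left of `c` and equals `1` to the right of `c + ε`. -/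
noncomputable def smoothStep (c ε x : ℝ) : ℝ := Real.smoothTransition ((x - c) / ε)

variable {c ε : ℝ}

theorem contDiff_smoothStep : ContDiff ℝ ∞ (smoothStep c ε) :=
  Real.smoothTransition.contDiff.comp ((contDiff_id.sub contDiff_const).div_const ε)

theorem smoothStep_of_le (hε : 0 < ε) {x : ℝ} (hx : x ≤ c) : smoothStep c ε x = 0 :=
  Real.smoothTransition.zero_of_nonpos (div_nonpos_of_nonpos_of_nonneg (sub_nonpos.2 hx) hε.le)

theorem smoothStep_of_ge (hε : 0 < ε) {x : ℝ} (hx : c + ε ≤ x) : smoothStep c ε x = 1 :=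
  Real.smoothTransition.one_of_one_le ((one_le_div hε).2 (by linarith))

theorem smoothStep_nonneg (x : ℝ) : 0 ≤ smoothStep c ε x := Real.smoothTransition.nonneg _

theorem smoothStep_le_one (x : ℝ) : smoothStep c ε x ≤ 1 := Real.smoothTransition.le_one _

theorem monotone_smoothStep (hε : 0 < ε) : Monotone (smoothStep c ε) := fun x y hxy =>
  Real.smoothTransition.monotone (by gcongr)

theorem deriv_smoothStep_nonneg (hε : 0 < ε) (x : ℝ) : 0 ≤ deriv (smoothStep c ε) x :=
  (monotone_smoothStep hε).deriv_nonneg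

theorem continuous_deriv_smoothStep : Continuous (deriv (smoothStep c ε)) :=
  contDiff_smoothStep.continuous_deriv (by simp)

theorem deriv_smoothStep_of_notMem (hε : 0 < ε) {x : ℝ} (hx : x ∉ Icc c (c + ε)) :
    deriv (smoothStep c ε) x = 0 := by
  rw [mem_Icc, not_and_or, not_le, not_le] at hx
  rcases hx with hx | hx
  · have : smoothStep c ε =ᶠ[𝓝 x] fun _ => 0 := by
      filter_upwards [gt_mem_nhds hx] with y hy using smoothStep_of_le hε hy.le
    rw [this.deriv_eq, deriv_const]
  · have : smoothStep c ε =ᶠ[𝓝 x] fun _ => 1 := by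
      filter_upwards [lt_mem_nhds hx] with y hy using smoothStep_of_ge hε hy.le
    rw [this.deriv_eq, deriv_const]

theorem integral_deriv_smoothStep (hε : 0 < ε) :
    ∫ x in Icc c (c + ε), deriv (smoothStep c ε) x = 1 := by
  rw [integral_Icc_eq_integral_Ioc, ← intervalIntegral.integral_of_le (by linarith),
    intervalIntegral.integral_deriv_eq_sub
      (fun x _ => contDiff_smoothStep.differentiable (by simp) x)
      (continuous_deriv_smoothStep.intervalIntegrable _ _),
    smoothStep_of_ge hε le_rfl, smoothStep_of_le hε le_rfl, sub_zero]

/-- The derivative of a smooth step is an approximation of the unit mass. -/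
theorem abs_integral_deriv_smoothStep_mul_sub_le (hε : 0 < ε) {U : ℝ → ℝ} {a η : ℝ} {I : Set ℝ}
    (hI : MeasurableSet I) (hcI : Icc c (c + ε) ⊆ I) (hU : ContinuousOn U (Icc c (c + ε)))
    (hη : ∀ x ∈ Icc c (c + ε), |U x - a| ≤ η) :
    |(∫ x in I, deriv (smoothStep c ε) x * U x) - a| ≤ η := by
  have h1 : ∫ x in I, deriv (smoothStep c ε) x * U x
      = ∫ x in Icc c (c + ε), deriv (smoothStep c ε) x * U x := by
    refine setIntegral_eq_of_subset_of_forall_sdiff_eq_zero hI hcI fun x hx => ?_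
    rw [deriv_smoothStep_of_notMem hε hx.2, zero_mul]
  have hi1 : IntegrableOn (fun x => deriv (smoothStep c ε) x * U x) (Icc c (c + ε)) :=
    (continuous_deriv_smoothStep.continuousOn.mul hU).integrableOn_compact isCompact_Icc
  have hi2 : IntegrableOn (fun x => deriv (smoothStep c ε) x) (Icc c (c + ε)) :=
    continuous_deriv_smoothStep.continuousOn.integrableOn_compact isCompact_Icc
  have h2 : a = ∫ x in Icc c (c + ε), deriv (smoothStep c ε) x * a := by
    rw [integral_mul_const, integral_deriv_smoothStep hε, one_mul]
  have h3 : η = ∫ x in Icc c (c + ε), deriv (smoothStep c ε) x * η := by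
    rw [integral_mul_const, integral_deriv_smoothStep hε, one_mul]
  rw [h1]
  nth_rewrite 1 [h2]
  rw [← integral_sub hi1 (hi2.mul_const a), ← Real.norm_eq_abs, h3]
  refine norm_integral_le_of_norm_le (hi2.mul_const η) ?_
  filter_upwards [ae_restrict_mem measurableSet_Icc] with x hx
  rw [← mul_sub, norm_mul, Real.norm_of_nonneg (deriv_smoothStep_nonneg hε x)]
  exact mul_le_mul_of_nonneg_left (hη x hx) (deriv_smoothStep_nonneg hε x)

end SmoothStep

/-- A continuous function with a bounded distributional derivative is its primitive. -/
theorem sub_eq_integral_of_weakDeriv {T : ℝ} {U M : ℝ → ℝ} (hU : ContinuousOn U (Icc 0 T))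
    (hM : AEStronglyMeasurable M (timeMeasure T)) {C : ℝ}
    (hC : ∀ᵐ t ∂timeMeasure T, |M t| ≤ C)
    (hw : ∀ h : ℝ → ℝ, IsTestFunction (Ioo 0 T) h →
      ∫ t, deriv h t * U t ∂timeMeasure T = - ∫ t, h t * M t ∂timeMeasure T)
    {s t : ℝ} (hs : 0 ≤ s) (hst : s ≤ t) (ht : t ≤ T) :
    U t - U s = ∫ τ in Ioo s t, M τ := by
  rcases hst.eq_or_lt with rfl | hst
  · simp
  -- The `5` leaves room for two disjoint steps of width `e n`, one on `[s + e n, s + 2 e n]` and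
  -- one on `[t - 2 e n, t - e n]`. Their difference `h n` has support inside `]0,T[` even if `s =
  -- 0` or `t = T`, and it tends to the indicator of `]s,t[`.
  let e : ℕ → ℝ := fun n => (t - s) / (n + 5)
  have he : ∀ n, 0 < e n := fun n => div_pos (sub_pos.2 hst) (by positivity)
  have he5 : ∀ n, 5 * e n ≤ t - s := fun n => by
    rw [← mul_div_assoc, div_le_iff₀ (by positivity)]
    nlinarith [(Nat.cast_nonneg n : (0 : ℝ) ≤ n)]
  have helim : Tendsto e atTop (𝓝 0) := by
    refine Tendsto.div_atTop tendsto_const_nhds ?_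
    exact tendsto_atTop_add_const_right _ _ tendsto_natCast_atTop_atTop
  let h : ℕ → ℝ → ℝ := fun n x => smoothStep (s + e n) (e n) x - smoothStep (t - 2 * e n) (e n) x
  have hsupp : ∀ n, tsupport (h n) ⊆ Icc (s + e n) (t - e n) := by
    intro n
    refine closure_minimal (fun x hx => ?_) isClosed_Icc
    by_contra hno
    rw [mem_Icc, not_and_or, not_le, not_le] at hno
    refine hx ?_
    rcases hno with hno | hno
    · simp only [h]
      rw [smoothStep_of_le (he n) hno.le, smoothStep_of_le (he n) (by linarith [he5 n, he n]),
        sub_zero]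
    · simp only [h]
      rw [smoothStep_of_ge (he n) (by linarith [he5 n, he n]),
        smoothStep_of_ge (he n) (by linarith [he5 n, he n]), sub_self]
  have hsub : ∀ n, Icc (s + e n) (t - e n) ⊆ Ioo 0 T := fun n x hx =>
    ⟨by linarith [hx.1, he n], by linarith [hx.2, he n]⟩
  have htest : ∀ n, IsTestFunction (Ioo 0 T) (h n) := fun n =>
    ⟨contDiff_smoothStep.sub contDiff_smoothStep,
      isCompact_Icc.of_isClosed_subset (isClosed_tsupport _) (hsupp n),
      (hsupp n).trans (hsub n)⟩
  have hderiv : ∀ n x, deriv (h n) x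
      = deriv (smoothStep (s + e n) (e n)) x - deriv (smoothStep (t - 2 * e n) (e n)) x :=
    fun n x => deriv_fun_sub (contDiff_smoothStep.differentiable (by simp) x)
      (contDiff_smoothStep.differentiable (by simp) x)
  obtain ⟨B, hB⟩ := isCompact_Icc.exists_bound_of_continuousOn hU
  have hUint : ∀ c ε, Integrable (fun x => deriv (smoothStep c ε) x * U x) (timeMeasure T) :=
    fun c ε => ((continuous_deriv_smoothStep.continuousOn.mul hU).integrableOn_compact
      isCompact_Icc).mono_set Ioo_subset_Icc_self
  -- the endpoint terms
  have hend : ∀ p ∈ Icc 0 T, ∀ c : ℕ → ℝ, Tendsto c atTop (𝓝 p) →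
      (∀ n, Icc (c n) (c n + e n) ⊆ Ioo 0 T) →
      Tendsto (fun n => ∫ x, deriv (smoothStep (c n) (e n)) x * U x ∂timeMeasure T) atTop
        (𝓝 (U p)) := by
    intro p hp c hc hcI
    rw [Metric.tendsto_nhds]
    intro η hη
    obtain ⟨δ, hδ, hUδ⟩ := Metric.continuousWithinAt_iff.1 (hU p hp) (η / 2) (half_pos hη)
    filter_upwards [(Metric.tendsto_nhds.1 hc) (δ / 2) (half_pos hδ),
      helim.eventually (gt_mem_nhds (half_pos hδ))] with n hn hen
    refine lt_of_le_of_lt ?_ (half_lt_self hη)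
    rw [Real.dist_eq]
    refine abs_integral_deriv_smoothStep_mul_sub_le (he n) measurableSet_Ioo (hcI n)
      (hU.mono ((hcI n).trans Ioo_subset_Icc_self)) fun x hx => ?_
    rw [← Real.dist_eq]
    refine (hUδ (Ioo_subset_Icc_self (hcI n hx)) ?_).le
    rw [Real.dist_eq, abs_lt] at hn ⊢
    constructor <;> linarith [hx.1, hx.2]
  have hlim1 := hend s ⟨hs, hst.le.trans ht⟩ (fun n => s + e n)
    (by simpa using helim.const_add s)
    (fun n x hx => hsub n ⟨hx.1, by linarith [hx.2, he5 n, he n]⟩)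
  have hlim2 := hend t ⟨hs.trans hst.le, ht⟩ (fun n => t - 2 * e n)
    (by simpa using (helim.const_mul 2).const_sub t)
    (fun n x hx => hsub n ⟨by linarith [hx.1, he5 n, he n], by linarith [hx.2]⟩)
  have hlhs : Tendsto (fun n => ∫ x, deriv (h n) x * U x ∂timeMeasure T) atTop
      (𝓝 (U s - U t)) := by
    refine (hlim1.sub hlim2).congr fun n => ?_
    rw [← integral_sub (hUint _ _) (hUint _ _)]
    refine integral_congr_ae (ae_of_all _ fun x => ?_)
    simp only [hderiv, sub_mul]
  have hrhs : Tendsto (fun n => ∫ x, h n x * M x ∂timeMeasure T) atTop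
      (𝓝 (∫ x, (Ioo s t).indicator M x ∂timeMeasure T)) := by
    refine tendsto_integral_of_dominated_convergence (fun _ => C)
      (fun n => (htest n).smooth.continuous.aestronglyMeasurable.mul hM) (integrable_const _)
      (fun n => ?_) (ae_of_all _ fun x => ?_)
    · filter_upwards [hC] with x hx
      rw [norm_mul]
      have h1 : ‖h n x‖ ≤ 1 := by
        rw [Real.norm_eq_abs, abs_le]
        constructor <;> simp only [h] <;>
          linarith [smoothStep_nonneg (c := s + e n) (ε := e n) x,
            smoothStep_nonneg (c := t - 2 * e n) (ε := e n) x,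
            smoothStep_le_one (c := s + e n) (ε := e n) x,
            smoothStep_le_one (c := t - 2 * e n) (ε := e n) x]
      exact (mul_le_of_le_one_left (norm_nonneg _) h1).trans hx
    · refine tendsto_nhds_of_eventually_eq ?_
      by_cases hx : x ∈ Ioo s t
      · rw [indicator_of_mem hx]
        have h1 : 0 < min (x - s) (t - x) := lt_min (sub_pos.2 hx.1) (sub_pos.2 hx.2)
        filter_upwards [helim.eventually (gt_mem_nhds (half_pos h1))] with n hn
        simp only [h]
        rw [smoothStep_of_ge (he n) (by linarith [min_le_left (x - s) (t - x)]),
          smoothStep_of_le (he n) (by linarith [min_le_right (x - s) (t - x)]), sub_zero, one_mul]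
      · refine Eventually.of_forall fun n => ?_
        rw [indicator_of_notMem hx]
        have : h n x = 0 := by
          by_contra hne
          have := hsupp n (subset_tsupport _ hne)
          exact hx ⟨by linarith [this.1, he n], by linarith [this.2, he n]⟩
        rw [this, zero_mul]
  have hlim : Tendsto (fun n => ∫ x, deriv (h n) x * U x ∂timeMeasure T) atTop
      (𝓝 (- ∫ x, (Ioo s t).indicator M x ∂timeMeasure T)) :=
    hrhs.neg.congr fun n => (hw _ (htest n)).symm
  have := tendsto_nhds_unique hlhs hlim
  rw [integral_indicator measurableSet_Ioo, timeMeasure,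
    Measure.restrict_restrict measurableSet_Ioo,
    inter_eq_left.2 (Ioo_subset_Ioo hs ht)] at this
  linarith

/-! ### The weak time derivative tested against Lipschitz functions -/

section TimeDerivative

variable {d : ℕ} {T : ℝ} {Ω : Set (Space d)} {u : ℝ → Space d → ℝ}

theorem exists_bound_of_continuousOn_uncurry (hb : Bornology.IsBounded Ω)
    (hu : ContinuousOn (fun p : ℝ × Space d => u p.1 p.2) (Icc 0 T ×ˢ closure Ω)) :
    ∃ B : ℝ, 0 ≤ B ∧ ∀ t ∈ Icc 0 T, ∀ x ∈ closure Ω, |u t x| ≤ B := by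
  obtain ⟨B, hB⟩ := (isCompact_Icc.prod hb.isCompact_closure).exists_bound_of_continuousOn hu
  exact ⟨|B|, abs_nonneg B, fun t ht x hx => (hB (t, x) ⟨ht, hx⟩).trans (le_abs_self B)⟩

theorem continuousOn_slice (hu : ContinuousOn (fun p : ℝ × Space d => u p.1 p.2)
    (Icc 0 T ×ˢ closure Ω)) {t : ℝ} (ht : t ∈ Icc 0 T) : ContinuousOn (u t) (closure Ω) :=
  hu.comp (f := fun x => (t, x)) (by fun_prop) fun _ hx => ⟨ht, hx⟩

theorem isFiniteMeasure_restrict_of_isBounded (hb : Bornology.IsBounded Ω) :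
    IsFiniteMeasure ((volume : Measure (Space d)).restrict Ω) :=
  ⟨by rw [Measure.restrict_apply_univ]; exact hb.measure_lt_top⟩

theorem continuousOn_integral_mul (hΩ : IsOpen Ω) (hb : Bornology.IsBounded Ω)
    (hu : ContinuousOn (fun p : ℝ × Space d => u p.1 p.2) (Icc 0 T ×ˢ closure Ω))
    {φ : Space d → ℝ} (hφ : Continuous φ) :
    ContinuousOn (fun t => ∫ x in Ω, u t x * φ x) (Icc 0 T) := by
  obtain ⟨B, hB0, hB⟩ := exists_bound_of_continuousOn_uncurry hb hu
  obtain ⟨D, hD⟩ := hb.isCompact_closure.exists_bound_of_continuousOn hφ.continuousOn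
  have := isFiniteMeasure_restrict_of_isBounded hb
  refine continuousOn_of_dominated (bound := fun _ => B * D) (fun t ht => ?_) (fun t ht => ?_)
    (integrable_const _) ?_
  · exact (((continuousOn_slice hu ht).mono subset_closure).mul
      hφ.continuousOn).aestronglyMeasurable hΩ.measurableSet
  · filter_upwards [ae_restrict_mem hΩ.measurableSet] with x hx
    rw [norm_mul]
    exact mul_le_mul (hB t ht x (subset_closure hx)) (hD x (subset_closure hx)) (norm_nonneg _) hB0
  · filter_upwards [ae_restrict_mem hΩ.measurableSet] with x hx
    exact (hu.comp (f := fun t => (t, x)) (by fun_prop)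
      fun _ ht => ⟨ht, subset_closure hx⟩).mul continuousOn_const

theorem isTestFunction_prod {h : ℝ → ℝ} {φ : Space d → ℝ} {I : Set ℝ} (hh : IsTestFunction I h)
    (hφ : IsTestFunction Ω φ) : IsTestFunction (I ×ˢ Ω) (fun p : ℝ × Space d => h p.1 * φ p.2) := by
  have hsub : tsupport (fun p : ℝ × Space d => h p.1 * φ p.2) ⊆ tsupport h ×ˢ tsupport φ := by
    refine closure_minimal (fun p hp => ?_)
      ((isClosed_tsupport _).prod (isClosed_tsupport _))
    exact ⟨subset_tsupport _ (left_ne_zero_of_mul hp), subset_tsupport _ (right_ne_zero_of_mul hp)⟩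
  exact ⟨(hh.smooth.comp contDiff_fst).mul (hφ.smooth.comp contDiff_snd),
    (hh.compact.prod hφ.compact).of_isClosed_subset (isClosed_tsupport _) hsub,
    hsub.trans (prod_mono hh.support hφ.support)⟩

variable {m : ℝ → SignedMeasure (Space d)}

theorem HasWeakTimeDerivative.integral_testFunction (hm : HasWeakTimeDerivative T Ω u m)
    {h : ℝ → ℝ} (hh : IsTestFunction (Ioo 0 T) h) {φ : Space d → ℝ} (hφ : IsTestFunction Ω φ) :
    ∫ t, deriv h t * (∫ x in Ω, u t x * φ x) ∂timeMeasure T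
      = - ∫ t, h t * signedIntegral (m t) φ ∂timeMeasure T := by
  have h1 := hm _ (isTestFunction_prod hh hφ)
  simp only [signedIntegral_const_mul] at h1
  rw [← h1]
  refine integral_congr_ae (ae_of_all _ fun t => ?_)
  simp only
  rw [← integral_const_mul]
  refine integral_congr_ae (ae_of_all _ fun x => ?_)
  simp only
  rw [deriv_mul_const (hh.smooth.differentiable (by simp) t)]
  ring

theorem MemLinftySigned.abs_signedIntegral_le {A : Set (Space d)} (hm : MemLinftySigned T A m) :
    ∃ C : ℝ, 0 ≤ C ∧ ∀ φ : Space d → ℝ, ∀ c : ℝ, 0 ≤ c → (∀ x ∈ A, |φ x| ≤ c) →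
      ∀ᵐ t ∂timeMeasure T, |signedIntegral (m t) φ| ≤ c * C := by
  obtain ⟨C, hC⟩ := hm.bounded
  refine ⟨C, C.2, fun φ c hc hφ => ?_⟩
  filter_upwards [hm.carried, hC] with t h1 h2
  refine (Sandpile.abs_signedIntegral_le h1 hφ).trans (mul_le_mul_of_nonneg_left ?_ hc)
  exact ENNReal.toReal_le_coe_of_le_coe h2

theorem MemLinftySigned.aestronglyMeasurable_of_lipschitz (hΩ : IsOpen Ω)
    (hb : Bornology.IsBounded Ω) (hm : MemLinftySigned T Ω m) {C : ℝ≥0} {φ : Space d → ℝ}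
    (hφ : LipschitzWith C φ) :
    AEStronglyMeasurable (fun t => signedIntegral (m t) φ) (timeMeasure T) := by
  obtain ⟨φn, B, hφn, hB, hlim⟩ := exists_testFunction_tendsto hΩ hb hφ
  refine aestronglyMeasurable_of_tendsto_ae atTop
    (fun n => hm.measurable (φn n) (hφn n).smooth.continuous (hφn n).compact) ?_
  filter_upwards [hm.carried] with t ht
  exact tendsto_signedIntegral ht (fun n => (hφn n).smooth.continuous) (fun n x _ => hB n x) hlim

/-- The definition allows only test functions supported in `Ω`. As `m t` does not charge `∂Ω`,
bounded pointwise limits on `Ω` suffice to reach functions that do not vanish at the boundary. -/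
theorem HasWeakTimeDerivative.integral_lipschitz (hΩ : IsOpen Ω) (hb : Bornology.IsBounded Ω)
    (hu : ContinuousOn (fun p : ℝ × Space d => u p.1 p.2) (Icc 0 T ×ˢ closure Ω))
    (hm : MemLinftySigned T Ω m) (hd : HasWeakTimeDerivative T Ω u m)
    {h : ℝ → ℝ} (hh : IsTestFunction (Ioo 0 T) h) {C : ℝ≥0} {φ : Space d → ℝ}
    (hφ : LipschitzWith C φ) :
    ∫ t, deriv h t * (∫ x in Ω, u t x * φ x) ∂timeMeasure T
      = - ∫ t, h t * signedIntegral (m t) φ ∂timeMeasure T := by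
  obtain ⟨φn, B, hφn, hB, hlim⟩ := exists_testFunction_tendsto hΩ hb hφ
  have hB0 : 0 ≤ B := (abs_nonneg _).trans (hB 0 0)
  obtain ⟨D, hD0, hD⟩ := exists_bound_of_continuousOn_uncurry hb hu
  obtain ⟨E, hE0, hE⟩ := hm.abs_signedIntegral_le
  obtain ⟨H, hH⟩ := hh.smooth.continuous.bounded_above_of_compact_support hh.compact
  have hh'c : Continuous (deriv h) := hh.smooth.continuous_deriv (by simp)
  obtain ⟨H', hH'⟩ := hh'c.bounded_above_of_compact_support hh.compact.deriv
  have := isFiniteMeasure_restrict_of_isBounded hb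
  have hT : ∀ᵐ t ∂timeMeasure T, t ∈ Icc 0 T :=
    (ae_restrict_mem measurableSet_Ioo).mono fun t ht => Ioo_subset_Icc_self ht
  have hbd : ∀ n, ∀ t ∈ Icc 0 T, ∀ᵐ x ∂volume.restrict Ω, ‖u t x * φn n x‖ ≤ D * B := by
    intro n t ht
    filter_upwards [ae_restrict_mem hΩ.measurableSet] with x hx
    rw [norm_mul]
    exact mul_le_mul (hD t ht x (subset_closure hx)) (hB n x) (norm_nonneg _) hD0
  have hl : Tendsto (fun n => ∫ t, deriv h t * (∫ x in Ω, u t x * φn n x) ∂timeMeasure T) atTop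
      (𝓝 (∫ t, deriv h t * (∫ x in Ω, u t x * φ x) ∂timeMeasure T)) := by
    refine tendsto_integral_of_dominated_convergence
      (fun _ => H' * (D * B * (volume.restrict Ω).real univ)) (fun n => ?_) (integrable_const _)
      (fun n => ?_) ?_
    · refine hh'c.aestronglyMeasurable.mul ?_
      exact ((continuousOn_integral_mul hΩ hb hu (hφn n).smooth.continuous).mono
        Ioo_subset_Icc_self).aestronglyMeasurable measurableSet_Ioo
    · filter_upwards [hT] with t ht
      rw [norm_mul]
      exact mul_le_mul (hH' t) (norm_integral_le_of_norm_le_const (hbd n t ht)) (norm_nonneg _)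
        ((norm_nonneg _).trans (hH' t))
    · filter_upwards [hT] with t ht
      refine Tendsto.const_mul _ (tendsto_integral_of_dominated_convergence (fun _ => D * B)
        (fun n => ?_) (integrable_const _) (fun n => hbd n t ht) ?_)
      · exact (((continuousOn_slice hu ht).mono subset_closure).mul
          (hφn n).smooth.continuous.continuousOn).aestronglyMeasurable hΩ.measurableSet
      · filter_upwards [ae_restrict_mem hΩ.measurableSet] with x hx
        exact (hlim x hx).const_mul _
  have hr : Tendsto (fun n => ∫ t, h t * signedIntegral (m t) (φn n) ∂timeMeasure T) atTop
      (𝓝 (∫ t, h t * signedIntegral (m t) φ ∂timeMeasure T)) := by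
    refine tendsto_integral_of_dominated_convergence (fun _ => H * (B * E)) (fun n => ?_)
      (integrable_const _) (fun n => ?_) ?_
    · exact hh.smooth.continuous.aestronglyMeasurable.mul
        (hm.measurable (φn n) (hφn n).smooth.continuous (hφn n).compact)
    · filter_upwards [hE (φn n) B hB0 fun x _ => hB n x] with t ht
      rw [norm_mul]
      exact mul_le_mul (hH t) ht (norm_nonneg _) ((norm_nonneg _).trans (hH t))
    · filter_upwards [hm.carried] with t ht
      exact (tendsto_signedIntegral ht (fun n => (hφn n).smooth.continuous)
        (fun n x _ => hB n x) hlim).const_mul _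
  refine tendsto_nhds_unique hl (hr.neg.congr fun n => ?_)
  rw [hd.integral_testFunction hh (hφn n)]

theorem HasWeakTimeDerivative.integral_sub (hΩ : IsOpen Ω) (hb : Bornology.IsBounded Ω)
    (hu : ContinuousOn (fun p : ℝ × Space d => u p.1 p.2) (Icc 0 T ×ˢ closure Ω))
    (hm : MemLinftySigned T Ω m) (hd : HasWeakTimeDerivative T Ω u m)
    {C : ℝ≥0} {φ : Space d → ℝ} (hφ : LipschitzWith C φ) {s t : ℝ} (hs : 0 ≤ s) (hst : s ≤ t)
    (ht : t ≤ T) :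
    (∫ x in Ω, u t x * φ x) - ∫ x in Ω, u s x * φ x = ∫ τ in Ioo s t, signedIntegral (m τ) φ := by
  obtain ⟨D, hD⟩ := hb.isCompact_closure.exists_bound_of_continuousOn hφ.continuous.continuousOn
  obtain ⟨E, hE0, hE⟩ := hm.abs_signedIntegral_le
  exact sub_eq_integral_of_weakDeriv (continuousOn_integral_mul hΩ hb hu hφ.continuous)
    (hm.aestronglyMeasurable_of_lipschitz hΩ hb hφ)
    (hE φ |D| (abs_nonneg D) fun x hx => (hD x (subset_closure hx)).trans (le_abs_self D))
    (fun h hh => hd.integral_lipschitz hΩ hb hu hm hh hφ) hs hst ht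

end TimeDerivative

/-! ### The equation at almost every time -/

/-- The test functions are separable in the `C¹` norm on a compact set. -/
theorem exists_seq_dense_testFunction {d : ℕ} {K : Set (Space d)} (hK : IsCompact K) :
    ∃ φn : ℕ → Space d → ℝ, (∀ n, IsTestFunction univ (φn n)) ∧
      ∀ φ, IsTestFunction univ φ → ∀ ε > 0, ∃ n, ∀ x ∈ K,
        |φ x - φn n x| ≤ ε ∧ ‖gradient φ x - gradient (φn n) x‖ ≤ ε := by
  have := isCompact_iff_compactSpace.1 hK
  -- The pairs `(φ, Dφ)` form a subset of a separable metric space, hence a separable one, and a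
  -- dense sequence can be chosen among them.
  let r : {φ : Space d → ℝ // IsTestFunction univ φ} → C(K, ℝ) × C(K, Space d) := fun φ =>
    (⟨fun x => φ.1 x, φ.2.smooth.continuous.comp continuous_subtype_val⟩,
      ⟨fun x => gradient φ.1 x, (continuous_gradient φ.2.smooth).comp continuous_subtype_val⟩)
  have hne : Nonempty (range r) := by
    refine ⟨r ⟨fun _ => 0, contDiff_const, HasCompactSupport.zero, subset_univ _⟩, mem_range_self _⟩
  choose φn hφn using fun n : ℕ => (TopologicalSpace.denseSeq (range r) n).2
  refine ⟨fun n => (φn n).1, fun n => (φn n).2, fun φ hφ ε hε => ?_⟩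
  obtain ⟨n, hn⟩ := (TopologicalSpace.denseRange_denseSeq (range r)).exists_dist_lt
    (⟨r ⟨φ, hφ⟩, mem_range_self _⟩ : range r) hε
  rw [Subtype.dist_eq, ← hφn n, Prod.dist_eq, max_lt_iff] at hn
  refine ⟨n, fun x hx => ⟨?_, ?_⟩⟩
  · rw [← Real.dist_eq]
    exact ((ContinuousMap.dist_apply_le_dist (⟨x, hx⟩ : K)).trans_lt hn.1).le
  · rw [← dist_eq_norm]
    exact ((ContinuousMap.dist_apply_le_dist (⟨x, hx⟩ : K)).trans_lt hn.2).le

section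

variable {d : ℕ} {T : ℝ} {Ω : Set (Space d)}

theorem IsTestFunction.exists_lipschitzWith {φ : Space d → ℝ} (hφ : IsTestFunction univ φ) :
    ∃ C : ℝ≥0, LipschitzWith C φ :=
  ContDiff.lipschitzWith_of_hasCompactSupport hφ.compact hφ.smooth (by simp)

theorem IsTestFunction.integrable_inner_gradient {η : Measure (Space d)} [IsFiniteMeasure η]
    {w : Space d → Space d} (hw : AEStronglyMeasurable w η) (hw1 : ∀ᵐ x ∂η, ‖w x‖ = 1)
    {φ : Space d → ℝ} (hφ : IsTestFunction univ φ) :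
    Integrable (fun x => inner ℝ (w x) (gradient φ x)) η := by
  have hgc : HasCompactSupport (gradient φ) :=
    HasCompactSupport.comp_left (hφ.compact.fderiv (𝕜 := ℝ)) (map_zero _)
  obtain ⟨B, hB⟩ := (continuous_gradient hφ.smooth).bounded_above_of_compact_support hgc
  refine Integrable.of_bound
    (hw.inner (continuous_gradient hφ.smooth).aestronglyMeasurable) B ?_
  filter_upwards [hw1] with x hx
  refine (norm_inner_le_norm _ _).trans ?_
  rw [hx, one_mul]
  exact hB x

theorem abs_signedIntegral_sub_le {K : Set (Space d)} (hK : IsCompact K)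
    {m : SignedMeasure (Space d)} (h : m.totalVariation Kᶜ = 0) {φ ψ : Space d → ℝ}
    (hφ : Continuous φ) (hψ : Continuous ψ) {c : ℝ} (hc : ∀ x ∈ K, |φ x - ψ x| ≤ c) :
    |signedIntegral m φ - signedIntegral m ψ| ≤ c * (m.totalVariation univ).toReal := by
  rw [← signedIntegral_sub hK h hφ.continuousOn hψ.continuousOn]
  exact abs_signedIntegral_le h hc

theorem eq_of_forall_abs_sub_le_mul {a b A : ℝ} (h : ∀ ε > 0, |a - b| ≤ ε * A) : a = b := by
  have h0 : Tendsto (fun ε : ℝ => ε * A) (𝓝[>] 0) (𝓝 0) := by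
    have : Tendsto (fun ε : ℝ => ε * A) (𝓝 0) (𝓝 (0 * A)) := tendsto_id.mul_const A
    rw [zero_mul] at this
    exact this.mono_left nhdsWithin_le_nhds
  have h1 : |a - b| ≤ 0 := ge_of_tendsto h0 (by
    filter_upwards [self_mem_nhdsWithin] with ε hε using h ε hε)
  exact sub_eq_zero.1 (abs_eq_zero.1 (le_antisymm h1 (abs_nonneg _)))

theorem totalVariation_compl_closure {m : SignedMeasure (Space d)}
    (h : m.totalVariation Ωᶜ = 0) : m.totalVariation (closure Ω)ᶜ = 0 :=
  measure_mono_null (compl_subset_compl.2 subset_closure) h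

theorem totalVariation_compl_closure_of_frontier {m : SignedMeasure (Space d)}
    (h : m.totalVariation (frontier Ω)ᶜ = 0) : m.totalVariation (closure Ω)ᶜ = 0 :=
  measure_mono_null (compl_subset_compl.2 frontier_subset_closure) h

theorem MemLinftySigned.integrable_signedIntegral {A : Set (Space d)}
    {m : ℝ → SignedMeasure (Space d)} (hm : MemLinftySigned T A m) {φ : Space d → ℝ}
    (hφ : IsTestFunction univ φ) :
    Integrable (fun t => signedIntegral (m t) φ) (timeMeasure T) := by
  obtain ⟨B, hB⟩ := hφ.smooth.continuous.bounded_above_of_compact_support hφ.compact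
  obtain ⟨C, hC0, hC⟩ := hm.abs_signedIntegral_le
  exact Integrable.of_bound (hm.measurable φ hφ.smooth.continuous hφ.compact) (B * C)
    (hC φ B ((norm_nonneg _).trans (hB 0)) fun x _ => hB x)

/-- The equation at almost every time, for one test function. -/
theorem SatisfiesPDE.ae_eq (hΩ : IsOpen Ω) (hb : Bornology.IsBounded Ω)
    {u : ℝ → Space d → ℝ} {f m ν : ℝ → SignedMeasure (Space d)} {μ : ℝ → Measure (Space d)}
    {w : ℝ → Space d → Space d}
    (hu : ContinuousOn (fun p : ℝ × Space d => u p.1 p.2) (Icc 0 T ×ˢ closure Ω))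
    (hm : MemLinftySigned T Ω m) (hd : HasWeakTimeDerivative T Ω u m)
    (hf : MemLinftySigned T Ω f) (hν : MemLinftySigned T (frontier Ω) ν)
    (hpde : SatisfiesPDE T Ω f u μ w ν) {φ : Space d → ℝ} (hφ : IsTestFunction univ φ) :
    ∀ᵐ t ∂timeMeasure T, ∫ x, inner ℝ (w t x) (gradient φ x) ∂μ t
      = signedIntegral (f t) φ - signedIntegral (ν t) φ - signedIntegral (m t) φ := by
  obtain ⟨C, hC⟩ := hφ.exists_lipschitzWith
  obtain ⟨hQ, heq⟩ := hpde φ hφ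
  have hFi := hf.integrable_signedIntegral hφ
  have hNi := hν.integrable_signedIntegral hφ
  have hMi := hm.integrable_signedIntegral hφ
  let R : ℝ → ℝ := fun t => (∫ x, inner ℝ (w t x) (gradient φ x) ∂μ t)
    - (signedIntegral (f t) φ - signedIntegral (ν t) φ - signedIntegral (m t) φ)
  have hR : Integrable R (timeMeasure T) := hQ.sub ((hFi.sub hNi).sub hMi)
  have hzero : ∀ᵐ t, t ∈ Ioo 0 T → R t = 0 := by
    refine isOpen_Ioo.ae_eq_zero_of_integral_contDiff_smul_eq_zero
      (IntegrableOn.locallyIntegrableOn hR) fun h hh hhc hhs => ?_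
    have hht : IsTestFunction (Ioo 0 T) h := ⟨hh, hhc, hhs⟩
    have h1 : ∫ t, h t • R t = ∫ t, h t • R t ∂timeMeasure T := by
      refine (setIntegral_eq_integral_of_forall_compl_eq_zero fun t ht => ?_).symm
      rw [image_eq_zero_of_notMem_tsupport fun h' => ht (hhs h'), zero_smul]
    obtain ⟨H, hH⟩ := hh.continuous.bounded_above_of_compact_support hhc
    have hmul : ∀ {g : ℝ → ℝ}, Integrable g (timeMeasure T) →
        Integrable (fun t => h t * g t) (timeMeasure T) := fun hg =>
      hg.bdd_mul hh.continuous.aestronglyMeasurable (ae_of_all _ hH)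
    have h2 : ∫ t, h t • R t ∂timeMeasure T
        = ∫ t, h t * (∫ x, inner ℝ (w t x) (gradient φ x) ∂μ t) ∂timeMeasure T
          - ∫ t, h t * (signedIntegral (f t) φ - signedIntegral (ν t) φ) ∂timeMeasure T
          + ∫ t, h t * signedIntegral (m t) φ ∂timeMeasure T := by
      have hFN : Integrable (fun t => signedIntegral (f t) φ - signedIntegral (ν t) φ)
        (timeMeasure T) := hFi.sub hNi
      have hQFN : Integrable (fun t => h t * (∫ x, inner ℝ (w t x) (gradient φ x) ∂μ t)
        - h t * (signedIntegral (f t) φ - signedIntegral (ν t) φ)) (timeMeasure T) :=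
        (hmul hQ).sub (hmul hFN)
      rw [← MeasureTheory.integral_sub (hmul hQ) (hmul hFN), ← integral_add hQFN (hmul hMi)]
      refine integral_congr_ae (ae_of_all _ fun t => ?_)
      simp only [R, smul_eq_mul]
      ring
    have h3 := heq h hht
    -- The term with `deriv h` is rewritten through `m`; since `φ` need not vanish on `∂Ω`, the
    -- Lipschitz version is required.
    have h4 := hd.integral_lipschitz hΩ hb hu hm hht hC
    rw [h1, h2]
    linarith
  filter_upwards [ae_timeMeasure_iff.2 hzero] with t ht
  exact sub_eq_zero.1 ht

/-- The equation at almost every time, for all test functions simultaneously. -/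
theorem SatisfiesPDE.ae_forall_eq (hΩ : IsOpen Ω) (hb : Bornology.IsBounded Ω)
    {u : ℝ → Space d → ℝ} {f m ν : ℝ → SignedMeasure (Space d)} {μ : ℝ → Measure (Space d)}
    {w : ℝ → Space d → Space d}
    (hu : ContinuousOn (fun p : ℝ × Space d => u p.1 p.2) (Icc 0 T ×ˢ closure Ω))
    (hm : MemLinftySigned T Ω m) (hd : HasWeakTimeDerivative T Ω u m)
    (hf : MemLinftySigned T Ω f) (hν : MemLinftySigned T (frontier Ω) ν)
    (hμ : MemLinftyPos T Ω μ) (hw : ∀ᵐ t ∂timeMeasure T, AEStronglyMeasurable (w t) (μ t))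
    (hw1 : ∀ᵐ t ∂timeMeasure T, ∀ᵐ x ∂μ t, ‖w t x‖ = 1)
    (hpde : SatisfiesPDE T Ω f u μ w ν) :
    ∀ᵐ t ∂timeMeasure T, ∀ φ : Space d → ℝ, IsTestFunction univ φ →
      ∫ x, inner ℝ (w t x) (gradient φ x) ∂μ t
      = signedIntegral (f t) φ - signedIntegral (ν t) φ - signedIntegral (m t) φ := by
  have hK := hb.isCompact_closure
  obtain ⟨φn, hφn, hdense⟩ := exists_seq_dense_testFunction hK
  obtain ⟨C, hC⟩ := hμ.bounded
  have hall := ae_all_iff.2 fun n => hpde.ae_eq hΩ hb hu hm hd hf hν (hφn n)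
  filter_upwards [hall, hm.carried, hf.carried, hν.carried, hμ.carried, hC, hw, hw1]
    with t hn hmt hft hνt hμt hCt hwt hw1t φ hφ
  have hmK := totalVariation_compl_closure hmt
  have hfK := totalVariation_compl_closure hft
  have hνK := totalVariation_compl_closure_of_frontier hνt
  have : IsFiniteMeasure (μ t) := ⟨hCt.trans_lt ENNReal.coe_lt_top⟩
  -- Both sides are continuous in `φ` for the `C¹` norm on the closure, with the total masses as
  -- constant. The exceptional null set is that of the countable dense family.
  refine eq_of_forall_abs_sub_le_mul (A := (μ t).real univ + ((f t).totalVariation univ).toReal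
    + ((ν t).totalVariation univ).toReal + ((m t).totalVariation univ).toReal) fun ε hε => ?_
  obtain ⟨n, hnε⟩ := hdense φ hφ ε hε
  have hcont := hφ.smooth.continuous
  have hcontn := (hφn n).smooth.continuous
  have h1 := abs_signedIntegral_sub_le hK hfK hcont hcontn fun x hx => (hnε x hx).1
  have h2 := abs_signedIntegral_sub_le hK hνK hcont hcontn fun x hx => (hnε x hx).1
  have h3 := abs_signedIntegral_sub_le hK hmK hcont hcontn fun x hx => (hnε x hx).1
  have h4 : |(∫ x, inner ℝ (w t x) (gradient φ x) ∂μ t)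
      - ∫ x, inner ℝ (w t x) (gradient (φn n) x) ∂μ t| ≤ ε * (μ t).real univ := by
    rw [← MeasureTheory.integral_sub (hφ.integrable_inner_gradient hwt hw1t)
      ((hφn n).integrable_inner_gradient hwt hw1t), ← Real.norm_eq_abs]
    refine norm_integral_le_of_norm_le_const ?_
    have hmem : ∀ᵐ x ∂μ t, x ∈ Ω := mem_ae_iff.2 hμt
    filter_upwards [hw1t, hmem] with x hx hxΩ
    rw [← inner_sub_right]
    refine (norm_inner_le_norm _ _).trans ?_
    rw [hx, one_mul]
    exact (hnε x (subset_closure hxΩ)).2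
  have h5 := hn n
  rw [abs_le] at h1 h2 h3 h4 ⊢
  constructor <;> linarith [h1.1, h1.2, h2.1, h2.2, h3.1, h3.2, h4.1, h4.2]

/-! ### Duality between the flux and the slope constraint -/

/-- The variational inequality: the flux `w η` with `w = D_η u` and `|w| = 1` has divergence `-Λ`,
and `u` maximises `Λ` among the `1`-Lipschitz functions. -/
theorem signedIntegral_le_of_tangentialGradient (hb : Bornology.IsBounded Ω)
    {η : Measure (Space d)} [IsFiniteMeasure η] (hη : η Ωᶜ = 0)
    {f m ν : SignedMeasure (Space d)} (hf : f.totalVariation (closure Ω)ᶜ = 0)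
    (hm : m.totalVariation (closure Ω)ᶜ = 0) (hν : ν.totalVariation (closure Ω)ᶜ = 0)
    {u : Space d → ℝ} {w : Space d → Space d} (hu : ContinuousOn u (closure Ω))
    (hw : HasTangentialGradientOn Ω η u w) (hw1 : ∀ᵐ x ∂η, ‖w x‖ = 1)
    (heq : ∀ φ : Space d → ℝ, IsTestFunction univ φ → ∫ x, inner ℝ (w x) (gradient φ x) ∂η
      = signedIntegral f φ - signedIntegral ν φ - signedIntegral m φ)
    {v : Space d → ℝ} (hv : LipschitzWith 1 v) :
    signedIntegral f v - signedIntegral ν v - signedIntegral m v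
      ≤ signedIntegral f u - signedIntegral ν u - signedIntegral m u := by
  have hK := hb.isCompact_closure
  let Λ : (Space d → ℝ) → ℝ := fun φ =>
    signedIntegral f φ - signedIntegral ν φ - signedIntegral m φ
  let A : ℝ := (f.totalVariation univ).toReal + (ν.totalVariation univ).toReal
    + (m.totalVariation univ).toReal
  have hA0 : 0 ≤ A := by positivity
  have hΛsub : ∀ φ ψ : Space d → ℝ, Continuous φ → Continuous ψ → ∀ c : ℝ,
      (∀ x ∈ closure Ω, |φ x - ψ x| ≤ c) → |Λ φ - Λ ψ| ≤ c * A := by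
    intro φ ψ hφ hψ c hc
    have h1 := abs_signedIntegral_sub_le hK hf hφ hψ hc
    have h2 := abs_signedIntegral_sub_le hK hν hφ hψ hc
    have h3 := abs_signedIntegral_sub_le hK hm hφ hψ hc
    simp only [Λ, A]
    rw [abs_le] at h1 h2 h3 ⊢
    constructor <;> linarith [h1.1, h1.2, h2.1, h2.2, h3.1, h3.2]
  obtain ⟨u', hu'c, -, hu'u, hwL, S, hS, vn, hvn, hvu', hweak⟩ := hw
  have hwm := hwL.aestronglyMeasurable
  -- Agreement on `Ω` alone would not be enough: `ν` lives on the boundary.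
  have hu'K : EqOn u' u (closure Ω) :=
    hu'u.of_subset_closure hu'c.continuousOn hu subset_closure subset_rfl
  -- After mollification `|Dg| ≤ 1`, and the cut-off adds no gradient on the closure; with `|w| = 1`
  -- the flux pairing is at most the mass of `η`.
  have hupper : Λ v ≤ η.real univ := by
    refine le_of_forall_pos_le_add fun ε hε => ?_
    have hδ : 0 < ε / (A + 1) := by positivity
    obtain ⟨g, hg, hgl, hgv⟩ := exists_contDiff_lipschitz_approx hv hδ
    obtain ⟨χ, hχ, -, hχ1⟩ := exists_cutoff hK isOpen_univ (subset_univ _)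
    have hφ := hχ.mul hg
    have hφg : ∀ x ∈ closure Ω, (fun y => χ y * g y) =ᶠ[𝓝 x] g := fun x hx => by
      filter_upwards [hχ1 x hx] with y hy
      rw [hy, one_mul]
    have h1 : Λ (fun y => χ y * g y) ≤ η.real univ := by
      have hb1 : ‖∫ x, inner ℝ (w x) (gradient (fun y => χ y * g y) x) ∂η‖ ≤ 1 * η.real univ := by
        refine norm_integral_le_of_norm_le_const ?_
        have hmem : ∀ᵐ x ∂η, x ∈ Ω := mem_ae_iff.2 hη
        filter_upwards [hw1, hmem] with x hx hxΩ
        refine (norm_inner_le_norm _ _).trans ?_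
        rw [hx, one_mul, norm_gradient, (hφg x (subset_closure hxΩ)).fderiv_eq]
        simpa using norm_fderiv_le_of_lipschitz ℝ (x₀ := x) hgl
      rw [one_mul, heq _ hφ] at hb1
      exact (le_abs_self _).trans hb1
    have h2 := hΛsub v (fun y => χ y * g y) hv.continuous hφ.smooth.continuous (ε / (A + 1))
      fun x hx => by rw [(hφg x hx).eq_of_nhds, abs_sub_comm]; exact hgv x
    have h3 : ε / (A + 1) * A ≤ ε := by
      rw [div_mul_eq_mul_div, div_le_iff₀ (by positivity)]
      nlinarith
    linarith [le_abs_self (Λ v - Λ fun y => χ y * g y)]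
  -- By the equation, `div (w η) = -Λ` is a finite measure. Hence `w` is itself an admissible field
  -- and takes its values in the tangent space.
  have hwX : MemTangentFields η w := by
    refine ⟨hwL, A, fun φ hφ c hc => ?_⟩
    simp_rw [real_inner_comm (w _)]
    rw [heq φ hφ]
    have h1 := abs_signedIntegral_le hf fun x _ => hc x
    have h2 := abs_signedIntegral_le hν fun x _ => hc x
    have h3 := abs_signedIntegral_le hm fun x _ => hc x
    simp only [A]
    rw [abs_le] at h1 h2 h3
    linarith [h1.2, h2.1, h3.1]
  have hww : ∫ x, inner ℝ (w x) (w x) ∂η = η.real univ := by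
    rw [integral_congr_ae (g := fun _ => (1 : ℝ))]
    · simp
    · filter_upwards [hw1] with x hx
      rw [real_inner_self_eq_norm_sq, hx, one_pow]
  -- Weak convergence is tested with `w` itself. Since `w` is tangential the projection drops out,
  -- and the pairing with `Dvₙ` is `Λ(vₙ)`.
  have hlim1 : Tendsto (fun n => Λ (vn n)) atTop (𝓝 (η.real univ)) := by
    have := hweak w hwL
    rw [hww] at this
    refine this.congr fun n => ?_
    refine Eq.trans (integral_congr_ae ?_) (heq _ (hvn n))
    filter_upwards [hS.mem w hwX] with x hx
    rw [Submodule.inner_starProjection_left_eq_right,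
      Submodule.starProjection_eq_self_iff.2 hx, real_inner_comm]
  have hlim2 : Tendsto (fun n => Λ (vn n)) atTop (𝓝 (Λ u')) := by
    rw [Metric.tendsto_nhds]
    intro ε hε
    have hδ : 0 < ε / (A + 1) := by positivity
    filter_upwards [Metric.tendstoUniformly_iff.1 hvu' _ hδ] with n hn
    have h1 := hΛsub (vn n) u' (hvn n).smooth.continuous hu'c (ε / (A + 1)) fun x _ => by
      rw [← Real.dist_eq, dist_comm]
      exact (hn x).le
    have h3 : ε / (A + 1) * A < ε := by
      rw [div_mul_eq_mul_div, div_lt_iff₀ (by positivity)]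
      nlinarith
    exact h1.trans_lt h3
  have hu : Λ u = η.real univ := by
    rw [← tendsto_nhds_unique hlim2 hlim1]
    simp only [Λ]
    rw [signedIntegral_congr hf hu'K, signedIntegral_congr hν hu'K, signedIntegral_congr hm hu'K]
  change Λ v ≤ Λ u
  rw [hu]
  exact hupper

end

/-! ### Flows governed by the variational inequality -/

section

variable {d : ℕ} {T : ℝ} {Ω : Set (Space d)}

/-- The properties of a solution on which the comparison principle rests: the measure-valued
variational inequality `⟨f - ν - ∂ₜu, v - u⟩ ≤ 0` for all `1`-Lipschitz `v`, with `m = ∂ₜu`. -/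
structure IsFlow (T : ℝ) (Ω : Set (Space d)) (g : Space d → ℝ)
    (f m ν : ℝ → SignedMeasure (Space d)) (u : ℝ → Space d → ℝ) : Prop where
  lipschitz : ∀ t ∈ Icc 0 T, LipschitzOnWith 1 (u t) (closure Ω)
  continuous : ContinuousOn (fun p : ℝ × Space d => u p.1 p.2) (Icc 0 T ×ˢ closure Ω)
  mem_f : MemLinftySigned T Ω f
  mem_m : MemLinftySigned T Ω m
  mem_ν : MemLinftySigned T (frontier Ω) ν
  increment : ∀ (C : ℝ≥0) (φ : Space d → ℝ), LipschitzWith C φ → ∀ s t : ℝ, 0 ≤ s → s ≤ t →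
    t ≤ T → (∫ x in Ω, u t x * φ x) - ∫ x in Ω, u s x * φ x
      = ∫ τ in Ioo s t, signedIntegral (m τ) φ
  variational : ∀ᵐ t ∂timeMeasure T, ∀ v : Space d → ℝ, LipschitzWith 1 v →
    signedIntegral (f t) v - signedIntegral (ν t) v - signedIntegral (m t) v
      ≤ signedIntegral (f t) (u t) - signedIntegral (ν t) (u t) - signedIntegral (m t) (u t)
  boundary : ∀ᵐ t ∂timeMeasure T, ∀ x ∈ frontier Ω, 0 ≤ u t x ∧ u t x ≤ g x
  boundary_neg : ∀ᵐ t ∂timeMeasure T, ∀ᵐ x ∂(ν t).toJordanDecomposition.negPart, u t x = 0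
  boundary_pos : ∀ᵐ t ∂timeMeasure T, ∀ᵐ x ∂(ν t).toJordanDecomposition.posPart, u t x = g x

theorem IsSolution.exists_isFlow (hΩ : IsOpen Ω) (hconv : Convex ℝ Ω)
    (hb : Bornology.IsBounded Ω) (hT : 0 < T) {g : Space d → ℝ}
    {f ν : ℝ → SignedMeasure (Space d)} {u₀ : Space d → ℝ} {u : ℝ → Space d → ℝ}
    {μ : ℝ → Measure (Space d)} (hf : MemLinftySigned T Ω f)
    (h : IsSolution T Ω g f u₀ u μ ν) : ∃ m, IsFlow T Ω g f m ν u := by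
  obtain ⟨m, hm, hd⟩ := h.mem_time_deriv
  obtain ⟨w, hw, hw1, hpde⟩ := h.flux
  have hT' : ∀ᵐ t ∂timeMeasure T, t ∈ Icc 0 T :=
    (ae_restrict_mem measurableSet_Ioo).mono fun t ht => Ioo_subset_Icc_self ht
  have hlip : ∀ t ∈ Icc 0 T, LipschitzOnWith 1 (u t) (closure Ω) := by
    refine lipschitzOnWith_of_ae hΩ hT h.continuous_space h.continuous_time ?_
    filter_upwards [h.slope, hT'] with t ⟨G, hG, hG1⟩ ht
    exact lipschitzOnWith_of_hasWeakGradient hΩ hconv hb (h.continuous_space t ht) hG hG1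
  have hcont := continuousOn_uncurry_of_lipschitz hΩ hb h.continuous_time hlip
  have hwm : ∀ᵐ t ∂timeMeasure T, AEStronglyMeasurable (w t) (μ t) := by
    filter_upwards [hw] with t ht
    obtain ⟨_, _, _, _, hL, _⟩ := ht
    exact hL.aestronglyMeasurable
  refine ⟨m, hlip, hcont, hf, hm, h.mem_ν,
    fun C φ hφ s t hs hst ht => hd.integral_sub hΩ hb hcont hm hφ hs hst ht, ?_, h.boundary,
    h.boundary_neg, h.boundary_pos⟩
  obtain ⟨C, hC⟩ := h.mem_μ.bounded
  filter_upwards [hpde.ae_forall_eq hΩ hb hcont hm hd hf h.mem_ν h.mem_μ hwm hw1, hT', hw, hw1,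
    hC, h.mem_μ.carried, hm.carried, hf.carried, h.mem_ν.carried]
    with t heq ht hwt hw1t hCt hμt hmt hft hνt v hv
  have : IsFiniteMeasure (μ t) := ⟨hCt.trans_lt ENNReal.coe_lt_top⟩
  exact signedIntegral_le_of_tangentialGradient hb hμt (totalVariation_compl_closure hft)
    (totalVariation_compl_closure hmt) (totalVariation_compl_closure_of_frontier hνt)
    (hlip t ht).continuousOn hwt hw1t heq hv

theorem memLinftySigned_zero (A : Set (Space d)) :
    MemLinftySigned T A (fun _ => (0 : SignedMeasure (Space d))) := by
  refine ⟨ae_of_all _ fun t => ?_, ⟨0, ae_of_all _ fun t => ?_⟩, fun φ _ _ => ?_⟩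
  · simp [SignedMeasure.totalVariation_zero]
  · simp [SignedMeasure.totalVariation_zero]
  · simp only [signedIntegral_zero]
    exact aestronglyMeasurable_const

/-- A state of a flow, kept fixed in time, is a flow without source. -/
theorem IsFlow.const (hT : 0 < T) {g : Space d → ℝ} {f m ν : ℝ → SignedMeasure (Space d)}
    {u : ℝ → Space d → ℝ} (h : IsFlow T Ω g f m ν u) {s : ℝ} (hs : s ∈ Icc 0 T) :
    IsFlow T Ω g (fun _ => 0) (fun _ => 0) (fun _ => 0) (fun _ => u s) where
  lipschitz _ _ := h.lipschitz s hs
  continuous := (h.lipschitz s hs).continuousOn.comp (by fun_prop) fun _ hp => hp.2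
  mem_f := memLinftySigned_zero _
  mem_m := memLinftySigned_zero _
  mem_ν := memLinftySigned_zero _
  increment C φ _ s t _ _ _ := by simp [signedIntegral_zero]
  variational := ae_of_all _ fun t v _ => by simp [signedIntegral_zero]
  boundary := by
    refine ae_of_all _ fun _ x hx => ?_
    -- The boundary inequalities are known only at almost every time; continuity in time carries
    -- them to the given `s`.
    obtain ⟨τ, hτ, hτs⟩ := exists_near_of_ae_timeMeasure hT h.boundary hs
    have hc : ContinuousOn (fun t => u t x) (Icc 0 T) :=
      h.continuous.comp (f := fun t => (t, x)) (by fun_prop)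
        fun _ ht => ⟨ht, frontier_subset_closure hx⟩
    have hlim : Tendsto (fun n => u (τ n) x) atTop (𝓝 (u s x)) :=
      (hc s hs).tendsto.comp (tendsto_nhdsWithin_iff.2
        ⟨hτs, Eventually.of_forall fun n => Ioo_subset_Icc_self (hτ n).1⟩)
    exact ⟨ge_of_tendsto' hlim fun n => ((hτ n).2 x hx).1,
      le_of_tendsto' hlim fun n => ((hτ n).2 x hx).2⟩
  boundary_neg := ae_of_all _ fun _ => by
    simp [SignedMeasure.toJordanDecomposition_zero, JordanDecomposition.zero_negPart]
  boundary_pos := ae_of_all _ fun _ => by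
    simp [SignedMeasure.toJordanDecomposition_zero, JordanDecomposition.zero_posPart]

/-! ### The comparison principle -/

/-- The competitors are `max u₁ u₂ = u₁ + p` for `u₁` and `min u₁ u₂ = u₂ - p` for `u₂`, which
respect the slope constraint. Adding the two inequalities leaves only terms paired with `p`. -/
theorem signedIntegral_posPart_sub_le (hb : Bornology.IsBounded Ω) {g : Space d → ℝ}
    {f₁ f₂ m₁ m₂ ν₁ ν₂ : SignedMeasure (Space d)} {u₁ u₂ : Space d → ℝ} (hf : f₂ ≤ f₁)
    (hf₁ : f₁.totalVariation (closure Ω)ᶜ = 0) (hf₂ : f₂.totalVariation (closure Ω)ᶜ = 0)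
    (hm₁ : m₁.totalVariation (closure Ω)ᶜ = 0) (hm₂ : m₂.totalVariation (closure Ω)ᶜ = 0)
    (hν₁ : ν₁.totalVariation (frontier Ω)ᶜ = 0) (hν₂ : ν₂.totalVariation (frontier Ω)ᶜ = 0)
    (hu₁ : LipschitzOnWith 1 u₁ (closure Ω)) (hu₂ : LipschitzOnWith 1 u₂ (closure Ω))
    (hv₁ : ∀ v : Space d → ℝ, LipschitzWith 1 v →
      signedIntegral f₁ v - signedIntegral ν₁ v - signedIntegral m₁ v
        ≤ signedIntegral f₁ u₁ - signedIntegral ν₁ u₁ - signedIntegral m₁ u₁)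
    (hv₂ : ∀ v : Space d → ℝ, LipschitzWith 1 v →
      signedIntegral f₂ v - signedIntegral ν₂ v - signedIntegral m₂ v
        ≤ signedIntegral f₂ u₂ - signedIntegral ν₂ u₂ - signedIntegral m₂ u₂)
    (hb₁ : ∀ x ∈ frontier Ω, 0 ≤ u₁ x) (hb₂ : ∀ x ∈ frontier Ω, u₂ x ≤ g x)
    (hν₁p : ∀ᵐ x ∂ν₁.toJordanDecomposition.posPart, u₁ x = g x)
    (hν₂n : ∀ᵐ x ∂ν₂.toJordanDecomposition.negPart, u₂ x = 0) :
    signedIntegral m₂ (fun x => max (u₂ x - u₁ x) 0)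
      ≤ signedIntegral m₁ (fun x => max (u₂ x - u₁ x) 0) := by
  have hK := hb.isCompact_closure
  have hν₁' := totalVariation_compl_closure_of_frontier hν₁
  have hν₂' := totalVariation_compl_closure_of_frontier hν₂
  have hc₁ := hu₁.continuousOn
  have hc₂ := hu₂.continuousOn
  obtain ⟨e₁, he₁, hee₁⟩ := hu₁.extend_real
  obtain ⟨e₂, he₂, hee₂⟩ := hu₂.extend_real
  set p : Space d → ℝ := fun x => max (u₂ x - u₁ x) 0 with hp
  have hpc : ContinuousOn p (closure Ω) := (hc₂.sub hc₁).sup continuousOn_const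
  have hp0 : ∀ x, 0 ≤ p x := fun x => le_max_right _ _
  have hmin : EqOn (fun x => min (e₁ x) (e₂ x)) (fun x => u₂ x - p x) (closure Ω) := by
    intro x hx
    simp only [hp, ← hee₁ hx, ← hee₂ hx]
    rcases le_total (u₂ x) (u₁ x) with h | h
    · simp [h]
    · simp [h]
  have hmax : EqOn (fun x => max (e₁ x) (e₂ x)) (fun x => u₁ x + p x) (closure Ω) := by
    intro x hx
    simp only [hp, ← hee₁ hx, ← hee₂ hx]
    rcases le_total (u₂ x) (u₁ x) with h | h
    · simp [h]
    · simp [h]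
  have h1 := hv₁ _ (by simpa using he₁.max he₂)
  have h2 := hv₂ _ (by simpa using he₁.min he₂)
  rw [signedIntegral_congr hf₁ hmax, signedIntegral_congr hm₁ hmax,
    signedIntegral_congr hν₁' hmax, signedIntegral_add hK hf₁ hc₁ hpc,
    signedIntegral_add hK hm₁ hc₁ hpc, signedIntegral_add hK hν₁' hc₁ hpc] at h1
  rw [signedIntegral_congr hf₂ hmin, signedIntegral_congr hm₂ hmin,
    signedIntegral_congr hν₂' hmin, signedIntegral_sub hK hf₂ hc₂ hpc,
    signedIntegral_sub hK hm₂ hc₂ hpc, signedIntegral_sub hK hν₂' hc₂ hpc] at h2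
  have h3 := signedIntegral_mono hf hK hf₁ hf₂ hpc hp0
  -- Where `u₁ = g` one has `u₂ ≤ g = u₁`, so `p` vanishes and only the negative part of `ν₁`
  -- contributes. Symmetrically, `u₂ = 0 ≤ u₁` removes the negative part of `ν₂`.
  have h4 : signedIntegral ν₁ p ≤ 0 := by
    have : ∫ x, p x ∂ν₁.toJordanDecomposition.posPart = 0 := by
      refine integral_eq_zero_of_ae ?_
      filter_upwards [hν₁p, ae_posPart_mem hν₁] with x hx hxf
      exact max_eq_right (by linarith [hb₂ x hxf])
    rw [signedIntegral, this, zero_sub]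
    exact neg_nonpos.2 (integral_nonneg hp0)
  have h5 : 0 ≤ signedIntegral ν₂ p := by
    have : ∫ x, p x ∂ν₂.toJordanDecomposition.negPart = 0 := by
      refine integral_eq_zero_of_ae ?_
      filter_upwards [hν₂n, ae_negPart_mem hν₂] with x hx hxf
      exact max_eq_right (by linarith [hb₁ x hxf])
    rw [signedIntegral, this, sub_zero]
    exact integral_nonneg hp0
  linarith

/-- Cut `[a,b]` into equal pieces shorter than `δ`: the errors add up to `ε (b - a)`. No
differentiability of `E` is needed. -/
theorem le_of_forall_increment_le {E : ℝ → ℝ} {a b : ℝ} (hab : a ≤ b)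
    (h : ∀ ε > 0, ∃ δ > 0, ∀ s ∈ Icc a b, ∀ t ∈ Icc a b, s ≤ t → t - s < δ →
      E t - E s ≤ ε * (t - s)) : E b ≤ E a := by
  suffices hε : ∀ ε > 0, E b - E a ≤ ε * (b - a) by
    have h0 : Tendsto (fun ε : ℝ => ε * (b - a)) (𝓝[>] 0) (𝓝 0) := by
      have : Tendsto (fun ε : ℝ => ε * (b - a)) (𝓝 0) (𝓝 (0 * (b - a))) :=
        tendsto_id.mul_const _
      rw [zero_mul] at this
      exact this.mono_left nhdsWithin_le_nhds
    have h1 : E b - E a ≤ 0 := ge_of_tendsto h0 (by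
      filter_upwards [self_mem_nhdsWithin] with ε hε' using hε ε hε')
    linarith
  intro ε hε
  obtain ⟨δ, hδ, hE⟩ := h ε hε
  obtain ⟨N, hN⟩ := exists_nat_gt ((b - a) / δ)
  have hN0 : (0 : ℝ) < N := (div_nonneg (sub_nonneg.2 hab) hδ.le).trans_lt hN
  have hr0 : 0 ≤ (b - a) / N := div_nonneg (sub_nonneg.2 hab) hN0.le
  have hrδ : (b - a) / N < δ := by rwa [div_lt_comm₀ hN0 hδ]
  have hNr : N * ((b - a) / N) = b - a := mul_div_cancel₀ _ hN0.ne'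
  generalize (b - a) / N = r at *
  have hmem : ∀ k : ℕ, k ≤ N → a + k * r ∈ Icc a b := fun k hk => by
    have h1 : (k : ℝ) * r ≤ N * r := mul_le_mul_of_nonneg_right (Nat.cast_le.2 hk) hr0
    have h2 : 0 ≤ (k : ℝ) * r := by positivity
    constructor <;> linarith
  have hind : ∀ k : ℕ, k ≤ N → E (a + k * r) - E a ≤ ε * (k * r) := by
    intro k
    induction k with
    | zero => simp
    | succ k ih =>
      intro hk
      have h1 := ih (by omega)
      have h2 := hE _ (hmem k (by omega)) _ (hmem (k + 1) hk) (by push_cast; linarith)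
        (by push_cast; linarith)
      push_cast at h2 ⊢
      linarith
  have := hind N le_rfl
  rwa [hNr, add_sub_cancel] at this

/-- Convexity of `r ↦ (r⁺)²`, with the tangent taken at `a`. -/
theorem sq_max_zero_sub_le (a b : ℝ) :
    max a 0 ^ 2 - max b 0 ^ 2 ≤ 2 * ((a - b) * max a 0) := by
  rcases le_total a 0 with ha | ha
  · rw [max_eq_right ha]
    nlinarith [sq_nonneg (max b 0)]
  · rw [max_eq_left ha]
    rcases le_total b 0 with hb | hb
    · rw [max_eq_right hb]
      nlinarith
    · rw [max_eq_left hb]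
      nlinarith [sq_nonneg (a - b)]

theorem MemLinftySigned.integrable_of_lipschitz (hΩ : IsOpen Ω) (hb : Bornology.IsBounded Ω)
    {m : ℝ → SignedMeasure (Space d)} (hm : MemLinftySigned T Ω m) {C : ℝ≥0} {φ : Space d → ℝ}
    (hφ : LipschitzWith C φ) : Integrable (fun t => signedIntegral (m t) φ) (timeMeasure T) := by
  obtain ⟨D, hD⟩ := hb.isCompact_closure.exists_bound_of_continuousOn hφ.continuous.continuousOn
  obtain ⟨E, hE0, hE⟩ := hm.abs_signedIntegral_le
  exact Integrable.of_bound (hm.aestronglyMeasurable_of_lipschitz hΩ hb hφ) (|D| * E)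
    (hE φ |D| (abs_nonneg D) fun x hx => (hD x (subset_closure hx)).trans (le_abs_self D))

section Comparison

variable {g : Space d → ℝ} {f₁ f₂ m₁ m₂ ν₁ ν₂ : ℝ → SignedMeasure (Space d)}
  {u₁ u₂ : ℝ → Space d → ℝ}

/-- A discrete chain rule. By convexity the increment of the energy is at most twice the increment
of `u₂ - u₁` paired with `p` frozen at the later time `t`. Replacing `p(t)` by `p(τ)`, for which the
pairing has a sign, costs `κ` times the total variations of `m₁` and `m₂`. -/
theorem IsFlow.exists_energy_increment_le (hΩ : IsOpen Ω) (hb : Bornology.IsBounded Ω)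
    (h₁ : IsFlow T Ω g f₁ m₁ ν₁ u₁) (h₂ : IsFlow T Ω g f₂ m₂ ν₂ u₂)
    (hf : ∀ᵐ t ∂timeMeasure T, f₂ t ≤ f₁ t) :
    ∃ A : ℝ, 0 ≤ A ∧ ∀ κ : ℝ, 0 ≤ κ → ∀ s t : ℝ, 0 ≤ s → s ≤ t → t ≤ T →
      (∀ τ ∈ Ioo s t, ∀ x ∈ closure Ω, |(u₂ t x - u₁ t x) - (u₂ τ x - u₁ τ x)| ≤ κ) →
      (∫ x in Ω, max (u₂ t x - u₁ t x) 0 ^ 2) - ∫ x in Ω, max (u₂ s x - u₁ s x) 0 ^ 2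
        ≤ κ * A * (t - s) := by
  have hK := hb.isCompact_closure
  have hfin := isFiniteMeasure_restrict_of_isBounded hb
  obtain ⟨C₁, hC₁⟩ := h₁.mem_m.bounded
  obtain ⟨C₂, hC₂⟩ := h₂.mem_m.bounded
  refine ⟨2 * (C₁ + C₂), by positivity, fun κ hκ s t hs hst ht hκz => ?_⟩
  have hsI : s ∈ Icc 0 T := ⟨hs, hst.trans ht⟩
  have htI : t ∈ Icc 0 T := ⟨hs.trans hst, ht⟩
  obtain ⟨e₁, he₁, hee₁⟩ := (h₁.lipschitz t htI).extend_real
  obtain ⟨e₂, he₂, hee₂⟩ := (h₂.lipschitz t htI).extend_real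
  -- `increment` takes globally Lipschitz functions, so `p(t)` is built from extensions of the two
  -- slices.
  let P : Space d → ℝ := fun x => max (e₂ x - e₁ x) 0
  have hP : LipschitzWith (max (1 + 1) 0) P := (he₂.sub he₁).max (LipschitzWith.const 0)
  have hPe : EqOn P (fun x => max (u₂ t x - u₁ t x) 0) (closure Ω) := fun x hx => by
    simp only [P, hee₁ hx, hee₂ hx]
  have hint : ∀ φ : Space d → ℝ, ContinuousOn φ (closure Ω) → Integrable φ (volume.restrict Ω) :=
    fun φ hφ => (hφ.integrableOn_compact hK).mono_set subset_closure
  have hc₁ : ∀ τ ∈ Icc 0 T, ContinuousOn (u₁ τ) (closure Ω) := fun τ hτ =>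
    (h₁.lipschitz τ hτ).continuousOn
  have hc₂ : ∀ τ ∈ Icc 0 T, ContinuousOn (u₂ τ) (closure Ω) := fun τ hτ =>
    (h₂.lipschitz τ hτ).continuousOn
  have hPc : ContinuousOn P (closure Ω) := hP.continuous.continuousOn
  have hpc : ∀ τ ∈ Icc 0 T, ContinuousOn (fun x => max (u₂ τ x - u₁ τ x) 0) (closure Ω) :=
    fun τ hτ => ((hc₂ τ hτ).sub (hc₁ τ hτ)).sup continuousOn_const
  have hsub : Ioo s t ⊆ Ioo 0 T := Ioo_subset_Ioo hs ht
  have hae : ∀ {q : ℝ → Prop}, (∀ᵐ τ ∂timeMeasure T, q τ) → ∀ᵐ τ ∂volume.restrict (Ioo s t), q τ :=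
    fun hq => ae_mono (Measure.restrict_mono hsub le_rfl) hq
  have hM₁ : Integrable (fun τ => signedIntegral (m₁ τ) P) (volume.restrict (Ioo s t)) :=
    IntegrableOn.mono_set (h₁.mem_m.integrable_of_lipschitz hΩ hb hP) hsub
  have hM₂ : Integrable (fun τ => signedIntegral (m₂ τ) P) (volume.restrict (Ioo s t)) :=
    IntegrableOn.mono_set (h₂.mem_m.integrable_of_lipschitz hΩ hb hP) hsub
  have hbound : ∫ τ in Ioo s t, (signedIntegral (m₂ τ) P - signedIntegral (m₁ τ) P)
      ≤ κ * (C₁ + C₂) * (t - s) := by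
    have : ∫ τ in Ioo s t, κ * ((C₁ : ℝ) + C₂) = κ * (C₁ + C₂) * (t - s) := by
      rw [setIntegral_const, smul_eq_mul, Real.volume_real_Ioo_of_le hst]
      ring
    rw [← this]
    refine integral_mono_ae (hM₂.sub hM₁) (integrable_const _) ?_
    filter_upwards [ae_restrict_mem measurableSet_Ioo, hae hf, hae h₁.mem_f.carried,
      hae h₂.mem_f.carried, hae h₁.mem_m.carried, hae h₂.mem_m.carried, hae h₁.mem_ν.carried,
      hae h₂.mem_ν.carried, hae h₁.variational, hae h₂.variational, hae h₁.boundary,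
      hae h₂.boundary, hae h₁.boundary_pos, hae h₂.boundary_neg, hae hC₁, hae hC₂]
      with τ hτ hfτ hf₁ hf₂ hm₁ hm₂ hν₁ hν₂ hv₁ hv₂ hb₁ hb₂ hp₁ hn₂ hC₁ hC₂
    have hτI : τ ∈ Icc 0 T := Ioo_subset_Icc_self (hsub hτ)
    have hm₁' := totalVariation_compl_closure hm₁
    have hm₂' := totalVariation_compl_closure hm₂
    have key := signedIntegral_posPart_sub_le hb hfτ (totalVariation_compl_closure hf₁)
      (totalVariation_compl_closure hf₂) hm₁' hm₂' hν₁ hν₂ (h₁.lipschitz τ hτI)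
      (h₂.lipschitz τ hτI) hv₁ hv₂ (fun x hx => (hb₁ x hx).1) (fun x hx => (hb₂ x hx).2) hp₁ hn₂
    have hdiff : ∀ x ∈ closure Ω, |P x - max (u₂ τ x - u₁ τ x) 0| ≤ κ := fun x hx => by
      rw [hPe hx]
      exact (abs_max_sub_max_le_abs _ _ _).trans (hκz τ hτ x hx)
    have hd₁ := abs_signedIntegral_le hm₁' hdiff
    have hd₂ := abs_signedIntegral_le hm₂' hdiff
    rw [signedIntegral_sub hK hm₁' hPc (hpc τ hτI)] at hd₁
    rw [signedIntegral_sub hK hm₂' hPc (hpc τ hτI)] at hd₂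
    have hT₁ := mul_le_mul_of_nonneg_left (ENNReal.toReal_le_coe_of_le_coe hC₁) hκ
    have hT₂ := mul_le_mul_of_nonneg_left (ENNReal.toReal_le_coe_of_le_coe hC₂) hκ
    rw [abs_le] at hd₁ hd₂
    linarith [hd₁.1, hd₂.2]
  rw [MeasureTheory.integral_sub hM₂ hM₁, ← h₁.increment _ P hP s t hs hst ht,
    ← h₂.increment _ P hP s t hs hst ht] at hbound
  have hi : ∀ τ ∈ Icc 0 T, Integrable (fun x => max (u₂ τ x - u₁ τ x) 0 ^ 2)
      (volume.restrict Ω) := fun τ hτ => hint _ ((hpc τ hτ).pow 2)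
  have hPi : ∀ v : Space d → ℝ, ContinuousOn v (closure Ω) →
      Integrable (fun x => v x * P x) (volume.restrict Ω) := fun v hv => hint _ (hv.mul hPc)
  have i1 := hPi _ (hc₁ t htI)
  have i2 := hPi _ (hc₁ s hsI)
  have i3 := hPi _ (hc₂ t htI)
  have i4 := hPi _ (hc₂ s hsI)
  have i12 : Integrable (fun x => u₁ t x * P x - u₁ s x * P x) (volume.restrict Ω) := i1.sub i2
  have i34 : Integrable (fun x => u₂ t x * P x - u₂ s x * P x) (volume.restrict Ω) := i3.sub i4
  have hle : (∫ x in Ω, max (u₂ t x - u₁ t x) 0 ^ 2) - ∫ x in Ω, max (u₂ s x - u₁ s x) 0 ^ 2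
      ≤ 2 * (((∫ x in Ω, u₂ t x * P x) - ∫ x in Ω, u₂ s x * P x)
        - ((∫ x in Ω, u₁ t x * P x) - ∫ x in Ω, u₁ s x * P x)) := by
    rw [← MeasureTheory.integral_sub (hi t htI) (hi s hsI), ← MeasureTheory.integral_sub i3 i4,
      ← MeasureTheory.integral_sub i1 i2, ← MeasureTheory.integral_sub i34 i12,
      ← integral_const_mul]
    refine integral_mono_ae ((hi t htI).sub (hi s hsI))
      ((i34.sub i12).const_mul 2) ?_
    filter_upwards [ae_restrict_mem hΩ.measurableSet] with x hx
    have := sq_max_zero_sub_le (u₂ t x - u₁ t x) (u₂ s x - u₁ s x)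
    simp only [hPe (subset_closure hx)]
    linarith
  linarith

/-- The comparison principle. -/
theorem IsFlow.le (hΩ : IsOpen Ω) (hb : Bornology.IsBounded Ω)
    (h₁ : IsFlow T Ω g f₁ m₁ ν₁ u₁) (h₂ : IsFlow T Ω g f₂ m₂ ν₂ u₂)
    (hf : ∀ᵐ t ∂timeMeasure T, f₂ t ≤ f₁ t) {s t : ℝ} (hs : 0 ≤ s) (hst : s ≤ t) (ht : t ≤ T)
    (hle : ∀ x ∈ closure Ω, u₂ s x ≤ u₁ s x) : ∀ x ∈ closure Ω, u₂ t x ≤ u₁ t x := by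
  have htI : t ∈ Icc 0 T := ⟨hs.trans hst, ht⟩
  let E : ℝ → ℝ := fun τ => ∫ x in Ω, max (u₂ τ x - u₁ τ x) 0 ^ 2
  have hEs : E s = 0 := by
    refine (setIntegral_congr_fun (g := fun _ => 0) hΩ.measurableSet fun x hx => ?_).trans
      (by simp)
    simp [hle x (subset_closure hx)]
  have hE : E t ≤ E s := by
    obtain ⟨A, hA, hinc⟩ := h₁.exists_energy_increment_le hΩ hb h₂ hf
    refine le_of_forall_increment_le hst fun ε hε => ?_
    -- `A` may vanish, hence `A + 1`. Uniform continuity of `u₂ - u₁` on the compact cylinder turns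
    -- this `κ` into a time step `δ`.
    have hκ : 0 < ε / (A + 1) := by positivity
    have huc := (isCompact_Icc.prod hb.isCompact_closure).uniformContinuousOn_of_continuous
      (h₂.continuous.sub h₁.continuous)
    obtain ⟨δ, hδ, hδz⟩ := Metric.uniformContinuousOn_iff.1 huc _ hκ
    refine ⟨δ, hδ, fun a ha b hb' hab hlt => ?_⟩
    refine (hinc (ε / (A + 1)) hκ.le a b (hs.trans ha.1) hab (hb'.2.trans ht)
      fun τ hτ x hx => ?_).trans (mul_le_mul_of_nonneg_right ?_ (sub_nonneg.2 hab))
    · rw [← Real.dist_eq]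
      refine (hδz (b, x) ⟨⟨by linarith [ha.1], hb'.2.trans ht⟩, hx⟩ (τ, x)
        ⟨⟨by linarith [ha.1, hτ.1], by linarith [hτ.2, hb'.2]⟩, hx⟩ ?_).le
      rw [Prod.dist_eq, dist_self, max_lt_iff]
      refine ⟨?_, hδ⟩
      rw [Real.dist_eq, abs_lt]
      constructor <;> linarith [hτ.1, hτ.2]
    · rw [div_mul_eq_mul_div, div_le_iff₀ (by positivity)]
      nlinarith
  have hc : ContinuousOn (fun x => max (u₂ t x - u₁ t x) 0) (closure Ω) :=
    ((h₂.lipschitz t htI).continuousOn.sub (h₁.lipschitz t htI).continuousOn).sup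
      continuousOn_const
  have hint : IntegrableOn (fun x => max (u₂ t x - u₁ t x) 0 ^ 2) Ω :=
    ((hc.pow 2).integrableOn_compact hb.isCompact_closure).mono_set subset_closure
  have hE0 : ∫ x in Ω, max (u₂ t x - u₁ t x) 0 ^ 2 = 0 :=
    le_antisymm (hE.trans_eq hEs) (integral_nonneg fun x => sq_nonneg _)
  rw [integral_eq_zero_iff_of_nonneg (fun x => sq_nonneg _) hint] at hE0
  have hzero : EqOn (fun x => max (u₂ t x - u₁ t x) 0) (fun _ => 0) Ω := by
    refine Measure.eqOn_open_of_ae_eq (μ := volume) ?_ hΩ (hc.mono subset_closure)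
      continuousOn_const
    filter_upwards [hE0] with x hx
    exact pow_eq_zero_iff two_ne_zero |>.1 hx
  have hzero' := hzero.of_subset_closure hc continuousOn_const subset_closure subset_rfl
  intro x hx
  have h := hzero' hx
  simp only at h
  linarith [le_max_left (u₂ t x - u₁ t x) 0]

end Comparison

end

end Sandpile

theorem mainTheorem3 (d : ℕ) (hd : 2 ≤ d) (Ω : Set (Sandpile.Space d))
    (hΩ_open : IsOpen Ω) (hΩ_convex : Convex ℝ Ω) (hΩ_bounded : Bornology.IsBounded Ω)
    (g : Sandpile.Space d → ℝ) (hg_nonneg : ∀ x ∈ frontier Ω, 0 ≤ g x)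
    (hg_bounded : ∃ M : ℝ, ∀ x ∈ frontier Ω, g x ≤ M)
    (hg_lsc : LowerSemicontinuousOn g (frontier Ω))
    (T : ℝ) (hT : 0 < T) :
    -- comparison principle
    (∀ (f₁ f₂ : ℝ → MeasureTheory.SignedMeasure (Sandpile.Space d))
        (a₁ a₂ : Sandpile.Space d → ℝ) (u₁ u₂ : ℝ → Sandpile.Space d → ℝ)
        (μ₁ μ₂ : ℝ → MeasureTheory.Measure (Sandpile.Space d))
        (ν₁ ν₂ : ℝ → MeasureTheory.SignedMeasure (Sandpile.Space d)),
      Sandpile.MemLinftySigned T Ω f₁ → Sandpile.MemLinftySigned T Ω f₂ →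
      (∀ᵐ t ∂Sandpile.timeMeasure T, f₂ t ≤ f₁ t) →
      (∀ x ∈ closure Ω, a₂ x ≤ a₁ x) →
      Sandpile.IsSolution T Ω g f₁ a₁ u₁ μ₁ ν₁ →
      Sandpile.IsSolution T Ω g f₂ a₂ u₂ μ₂ ν₂ →
      ∀ t ∈ Set.Icc 0 T, ∀ x ∈ closure Ω, u₂ t x ≤ u₁ t x) ∧
    -- uniqueness of `u`
    (∀ (f : ℝ → MeasureTheory.SignedMeasure (Sandpile.Space d))
        (a : Sandpile.Space d → ℝ) (u₁ u₂ : ℝ → Sandpile.Space d → ℝ)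
        (μ₁ μ₂ : ℝ → MeasureTheory.Measure (Sandpile.Space d))
        (ν₁ ν₂ : ℝ → MeasureTheory.SignedMeasure (Sandpile.Space d)),
      Sandpile.MemLinftySigned T Ω f →
      Sandpile.IsSolution T Ω g f a u₁ μ₁ ν₁ →
      Sandpile.IsSolution T Ω g f a u₂ μ₂ ν₂ →
      ∀ t ∈ Set.Icc 0 T, ∀ x ∈ closure Ω, u₁ t x = u₂ t x) ∧
    -- monotonicity in time, for a non-negative source
    (∀ (f : ℝ → MeasureTheory.SignedMeasure (Sandpile.Space d))
        (a : Sandpile.Space d → ℝ) (u : ℝ → Sandpile.Space d → ℝ)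
        (μ : ℝ → MeasureTheory.Measure (Sandpile.Space d))
        (ν : ℝ → MeasureTheory.SignedMeasure (Sandpile.Space d)),
      Sandpile.MemLinftySigned T Ω f →
      (∀ᵐ t ∂Sandpile.timeMeasure T, 0 ≤ f t) →
      Sandpile.IsSolution T Ω g f a u μ ν →
      ∀ x ∈ closure Ω, MonotoneOn (fun t => u t x) (Set.Icc 0 T)) := by
  refine ⟨fun f₁ f₂ a₁ a₂ u₁ u₂ μ₁ μ₂ ν₁ ν₂ hf₁ hf₂ hf ha h₁ h₂ => ?_,
    fun f a u₁ u₂ μ₁ μ₂ ν₁ ν₂ hf h₁ h₂ => ?_, fun f a u μ ν hf hf0 h => ?_⟩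
  · obtain ⟨m₁, F₁⟩ := h₁.exists_isFlow hΩ_open hΩ_convex hΩ_bounded hT hf₁
    obtain ⟨m₂, F₂⟩ := h₂.exists_isFlow hΩ_open hΩ_convex hΩ_bounded hT hf₂
    intro t ht
    refine F₁.le hΩ_open hΩ_bounded F₂ hf le_rfl ht.1 ht.2 fun x hx => ?_
    rw [h₁.initial x hx, h₂.initial x hx]
    exact ha x hx
  · obtain ⟨m₁, F₁⟩ := h₁.exists_isFlow hΩ_open hΩ_convex hΩ_bounded hT hf
    obtain ⟨m₂, F₂⟩ := h₂.exists_isFlow hΩ_open hΩ_convex hΩ_bounded hT hf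
    have h0 : ∀ x ∈ closure Ω, u₁ 0 x = u₂ 0 x := fun x hx => by
      rw [h₁.initial x hx, h₂.initial x hx]
    intro t ht x hx
    exact le_antisymm
      (F₂.le hΩ_open hΩ_bounded F₁ (ae_of_all _ fun _ => le_rfl) le_rfl ht.1 ht.2
        (fun y hy => (h0 y hy).le) x hx)
      (F₁.le hΩ_open hΩ_bounded F₂ (ae_of_all _ fun _ => le_rfl) le_rfl ht.1 ht.2
        (fun y hy => (h0 y hy).ge) x hx)
  · obtain ⟨m, F⟩ := h.exists_isFlow hΩ_open hΩ_convex hΩ_bounded hT hf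
    intro x hx s hs t ht hst
    -- The competitor is the frozen state `u s`: it agrees with the flow at time `s` and has source
    -- `0 ≤ f`.
    exact F.le hΩ_open hΩ_bounded (F.const hT hs) hf0 hs.1 hst ht.2 (fun _ _ => le_rfl) x hx
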